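/- Let $(\boldsymbol X_i,Y_i)$, $i=1,2,\dots$, be i.i.d. copies of $(\boldsymbol X,Y)\in\mathbb R^d\times\mathbb R$ from the single index model $$E(Y\mid \boldsymbol X)=\psi_0(\boldsymbol\alpha_0^T\boldsymbol X),\qquad \|\boldsymbol\alpha_0\|=1,$$ where $\boldsymbol X$ is bounded, $EY^2<\infty$, and the conditional error variance $E\bigl[\{Y-\psi_0(\boldsymbol\alpha_0^T\boldsymbol X)\}^2\mid\boldsymbol X\bigr]$ is bounded by a constant. For an interval $[a,b]$ let $\mathcal S_2[a,b]$ be the class of differentiable functions $\psi$ on $[a,b]$ with absolutely continuous derivative and $\int_a^b\psi''(t)^2\,dt<\infty$. Assume that for all $\boldsymbol\alpha$ in the unit sphere sufficiently close to $\boldsymbol\alpha_0$ (including $\boldsymbol\alpha_0$) there is a compact interval $I_{\boldsymbol\alpha}$ with $\boldsymbol\alpha^T\boldsymbol X\in I_{\boldsymbol\alpha}$ a.s. such that (i) $u\mapsto E(\boldsymbol X\mid\boldsymbol\alpha^T\boldsymbol X=u)$ has a version that is differentiable on $I_{\boldsymbol\alpha}$ with Lipschitz continuous derivative; (ii) $\psi_{\boldsymbol\alpha}(u)=E\{\psi_0(\boldsymbol\alpha_0^T\boldsymbol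 X)\mid\boldsymbol\alpha^T\boldsymbol X=u\}$ has a version in $\mathcal S_2(I_{\boldsymbol\alpha})$ (for $\boldsymbol\alpha=\boldsymbol\alpha_0$ this is a condition on $\psi_0$). Let the penalty parameters $\mu_n>0$ be (possibly random and data-dependent) with $\mu_n=o_p(n^{-1/2})$ and $\mu_n^{-1}=O_p(n^{4/5})$. For $\boldsymbol\alpha$ in the unit sphere let $\hat\psi_{n\boldsymbol\alpha}$ be the natural cubic smoothing spline, i.e. a minimizer of $$\frac1n\sum_{i=1}^n\{Y_i-\psi(\boldsymbol\alpha^T\boldsymbol X_i)\}^2+\mu_n\int_a^b\psi''(t)^2\,dt,\qquad a=\min_{i\le n}\boldsymbol\alpha^T\boldsymbol X_i,\quad b=\max_{i\le n}\boldsymbol\alpha^T\boldsymbol X_i,$$ over $\psi\in\mathcal S_2[a,b]$, with derivative $\hat\psi'_{n\boldsymbol\alpha}$ on $[a,b]$ (one-sided at the end points). Then there is a neighborhood of $\boldsymbol\alpha_0$ in the unit sphere such that for each $\boldsymbol\alpha$ in it, as $n\to\infty$, $$\frac1n\sum_{i=1}^n E(\boldsymbol X_i\mid\boldsymbol\alpha^T\boldsymbol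 X_i)\,\{Y_i-\hat\psi_{n\boldsymbol\alpha}(\boldsymbol\alpha^T\boldsymbol X_i)\}\,\hat\psi'_{n\boldsymbol\alpha}(\boldsymbol\alpha^T\boldsymbol X_i)=O_p(\mu_n),$$ and this quantity is also $o_p(n^{-1/2})$. -/

import Mathlib

open MeasureTheory ProbabilityTheory Filter Topology Set
open scoped RealInnerProductSpace ENNReal

noncomputable section

namespace SplineSIM

/-- `Z n = O_p (R n)`: for every `ε > 0` there is `M` such that
`P (‖Z n‖ > M |R n|) ≤ ε` for all large `n`. The rate may be random. -/
def BigOp {Ω E : Type*} [MeasurableSpace Ω] [Norm E] (P : Measure Ω)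
    (Z : ℕ → Ω → E) (R : ℕ → Ω → ℝ) : Prop :=
  ∀ ε : ℝ, 0 < ε → ∃ M : ℝ, 0 < M ∧
    ∀ᶠ n in atTop, P {ω | M * |R n ω| < ‖Z n ω‖} ≤ ENNReal.ofReal ε

/-- `Z n = o_p (R n)`: for every `c > 0`, `P (‖Z n‖ > c |R n|) → 0`. -/
def LittleOp {Ω E : Type*} [MeasurableSpace Ω] [Norm E] (P : Measure Ω)
    (Z : ℕ → Ω → E) (R : ℕ → Ω → ℝ) : Prop :=
  ∀ c : ℝ, 0 < c → Tendsto (fun n => P {ω | c * |R n ω| < ‖Z n ω‖}) atTop (𝓝 0)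

/-- The second derivative of `ψ` on `[a, b]` (defined almost everywhere on `[a, b]` when the first
derivative is absolutely continuous there). -/
def secondDeriv (a b : ℝ) (ψ : ℝ → ℝ) : ℝ → ℝ :=
  deriv (derivWithin ψ (Icc a b))

/-- The class `S₂[a, b]`: differentiable functions on `[a, b]` with an absolutely continuous
derivative and a finite roughness penalty `∫ₐᵇ ψ''(x)² dx`. (Functions of infinite penalty can never
minimize the penalized least squares criterion below.) Only values on `[a, b]` matter. -/
structure MemS2 (a b : ℝ) (ψ : ℝ → ℝ) : Prop where
  differentiableOn : DifferentiableOn ℝ ψ (Icc a b)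
  absolutelyContinuous : AbsolutelyContinuousOnInterval (derivWithin ψ (Icc a b)) a b
  sq_integrable : IntervalIntegrable (fun x => secondDeriv a b ψ x ^ 2) volume a b

/-- Smallest design point. -/
def lo {n : ℕ} (t : Fin n → ℝ) : ℝ := ⨅ i, t i

/-- Largest design point. -/
def hi {n : ℕ} (t : Fin n → ℝ) : ℝ := ⨆ i, t i

/-- The criterion `n⁻¹ ∑ (yᵢ - ψ(tᵢ))² + μ ∫ₐᵇ ψ''(x)² dx`, with `a = min tᵢ`, `b = max tᵢ`. -/
def splineCriterion {n : ℕ} (t y : Fin n → ℝ) (μ : ℝ) (ψ : ℝ → ℝ) : ℝ :=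
  (n : ℝ)⁻¹ * ∑ i, (y i - ψ (t i)) ^ 2
    + μ * ∫ x in (lo t)..(hi t), secondDeriv (lo t) (hi t) ψ x ^ 2

/-- `ψ` is a smoothing spline for the data `(tᵢ, yᵢ)` with penalty parameter `μ`: it minimizes
the penalized least squares criterion over `S₂[min tᵢ, max tᵢ]`. -/
def IsSmoothingSpline {n : ℕ} (t y : Fin n → ℝ) (μ : ℝ) (ψ : ℝ → ℝ) : Prop :=
  MemS2 (lo t) (hi t) ψ ∧
    ∀ φ : ℝ → ℝ, MemS2 (lo t) (hi t) φ → splineCriterion t y μ ψ ≤ splineCriterion t y μ φ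

variable {Ω : Type*} [MeasurableSpace Ω] {d : ℕ}

/-- The index `αᵀ X`. -/
def index (α : EuclideanSpace ℝ (Fin d)) (X : Ω → EuclideanSpace ℝ (Fin d)) (ω : Ω) : ℝ :=
  ⟪α, X ω⟫

/-- The σ-algebra generated by `αᵀ X`. -/
abbrev indexSigma (α : EuclideanSpace ℝ (Fin d)) (X : Ω → EuclideanSpace ℝ (Fin d)) :
    MeasurableSpace Ω :=
  MeasurableSpace.comap (index α X) inferInstance

/-- The design points `αᵀ X₁, …, αᵀ Xₙ` of the first `n` observations (indexed from `0`). -/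
def design (α : EuclideanSpace ℝ (Fin d)) (X : ℕ → Ω → EuclideanSpace ℝ (Fin d))
    (n : ℕ) (ω : Ω) : Fin n → ℝ :=
  fun i => index α (X i) ω

/-- Regularity in the direction `α`: on some compact interval that contains `αᵀ X` almost surely,
the regression function `u ↦ E(X | αᵀ X = u)` has a Lipschitz continuous derivative and the function
`ψ_α(u) = E(ψ₀(α₀ᵀ X) | αᵀ X = u)` has an absolutely continuous derivative with square integrable
second derivative. -/
def RegularDirection (P : Measure Ω) (X : Ω → EuclideanSpace ℝ (Fin d))
    (ψ₀ : ℝ → ℝ) (α₀ α : EuclideanSpace ℝ (Fin d)) : Prop :=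
  ∃ (A B : ℝ) (h : ℝ → EuclideanSpace ℝ (Fin d)) (ψ : ℝ → ℝ),
    (∀ᵐ ω ∂P, index α X ω ∈ Icc A B) ∧
    P[X | indexSigma α X] =ᵐ[P] (fun ω => h (index α X ω)) ∧
    DifferentiableOn ℝ h (Icc A B) ∧
    (∃ L, LipschitzOnWith L (derivWithin h (Icc A B)) (Icc A B)) ∧
    P[fun ω => ψ₀ (index α₀ X ω) | indexSigma α X] =ᵐ[P] (fun ω => ψ (index α X ω)) ∧
    MemS2 A B ψ

/-- The score `∫ E(X | αᵀX) {y - ψ(αᵀx)} ψ'(αᵀx) dℙₙ(x, y)`, where `ℙₙ` is the empirical measure of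
the first `n` observations; `ψ'` is the derivative on `[minᵢ αᵀXᵢ, maxᵢ αᵀXᵢ]`, one-sided at
the end points (which is also the derivative there of the linear extension of `ψ`). -/
def score (P : Measure Ω) (X : ℕ → Ω → EuclideanSpace ℝ (Fin d)) (Y : ℕ → Ω → ℝ)
    (α : EuclideanSpace ℝ (Fin d)) (n : ℕ) (ψ : ℝ → ℝ) (ω : Ω) : EuclideanSpace ℝ (Fin d) :=
  (n : ℝ)⁻¹ • ∑ i : Fin n,
    ((Y i ω - ψ (design α X n ω i)) *
      derivWithin ψ (Icc (lo (design α X n ω)) (hi (design α X n ω))) (design α X n ω i)) •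
      (P[X i | indexSigma α (X i)]) ω

end SplineSIM

end

/-! The score is the penalized least squares normal equation tested with the weight `⟪v, h⟫ ψ'`,
where `h(u) = E(X | αᵀX = u)` and `‖v‖ ≤ 1`; its size is therefore governed by the penalty. There
are two deterministic ingredients and one stochastic one.

Score identity (`IsSmoothingSpline.abs_score_le`). Let `v(u) = n⁻¹ ∑ (yᵢ - ψ(tᵢ)) (tᵢ - u)₊`.
Residuals are orthogonal to affine functions, so Taylor's formula gives `n⁻¹ ∑ (yᵢ - ψ(tᵢ)) φ(tᵢ) =
∫ v φ''`. The Euler-Lagrange equation then forces `μ ψ'' = v`. Hence `w = ψ''` is continuous,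
piecewise linear and zero at both end points, and `φ = H ψ'` is an admissible test function: the
score equals `μ ∫ w (H ψ')''`. Since `H w w' = H (w²)' / 2`, one integration by parts removes `w'`
and leaves `μ ∫ (w H'' ψ' + (3/2) H' w²)`. This is `O(μ)` once `ψ'` and `∫ w²` are bounded.

Boundedness (`exists_score_bound`). Comparing the spline with `ψ_α` bounds the empirical squared
distance by a multiple of `μ` and `∫ ψ''²` by a constant, provided the noise functional `φ ↦ n⁻¹ ∑
eᵢ φ(tᵢ)` is small relative to the empirical norm and roughness of `φ`, and `μ` is at least a
multiple of `n^(-4/5)`. The spline is then bounded at some design point in each of two separated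
half-lines, so `ψ'` is bounded somewhere by the mean value theorem, and everywhere because `∫ |ψ''|`
is bounded.

Noise (`sq_sum_noise_le`, `CenteredNoise.exists_noiseControlled`). No entropy argument is needed.
Cut `[A, B]` into cells of width `h = n^(-1/5)`. On each cell `φ` is affine plus a Taylor remainder
linear in `φ''`. Cauchy-Schwarz gives a bound simultaneous in `φ` by three random quantities free of
`φ`: squared projections of the noise on affine functions, the same weighted by cell counts, and the
squared `L²` norm of the remainder's representer. Their expectations need only second moments, and
Markov's inequality finishes. The noise is `Y - ψ_α(αᵀX)`, which is centered given `αᵀX` with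
bounded conditional second moment.

The law of large numbers supplies the mass in the two half-lines unless `αᵀX` is almost surely
constant, in which case the score is zero. The second rate follows from the first and `μ =
o_p(n^(-1/2))`. -/

noncomputable section

namespace SplineSIM

/-! ### Functions with absolutely continuous derivative: Taylor formula and linearity. -/

section Taylor

variable {a b : ℝ} {φ p : ℝ → ℝ}

/-- `φ` is differentiable on `[a, b]` with absolutely continuous derivative `p`. -/
structure HasACDeriv (a b : ℝ) (φ p : ℝ → ℝ) : Prop where
  hasDeriv : ∀ x ∈ Icc a b, HasDerivWithinAt φ (p x) (Icc a b) x
  ac : AbsolutelyContinuousOnInterval p a b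

lemma MemS2.hasACDeriv (h : MemS2 a b φ) : HasACDeriv a b φ (derivWithin φ (Icc a b)) :=
  ⟨fun x hx => (h.differentiableOn x hx).hasDerivWithinAt, h.absolutelyContinuous⟩

lemma HasACDeriv.derivWithin_eq (h : HasACDeriv a b φ p) (hab : a < b) {x : ℝ}
    (hx : x ∈ Icc a b) : derivWithin φ (Icc a b) x = p x :=
  (h.hasDeriv x hx).derivWithin (uniqueDiffOn_Icc hab x hx)

/-- At an end point the two-sided `deriv` sees values outside the interval, where nothing is known
about `p`. Hence the open interval here and the almost everywhere statements below. -/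
lemma HasACDeriv.secondDeriv_eq (h : HasACDeriv a b φ p) (hab : a < b) {x : ℝ}
    (hx : x ∈ Ioo a b) : secondDeriv a b φ x = deriv p x := by
  apply Filter.EventuallyEq.deriv_eq
  filter_upwards [Icc_mem_nhds hx.1 hx.2] with y hy using h.derivWithin_eq hab hy

lemma ae_mem_Ioo_of_mem_Ioc (a b : ℝ) : ∀ᵐ x : ℝ, x ∈ Ioc a b → x ∈ Ioo a b := by
  have : ∀ᵐ x : ℝ, x ≠ b := by simp [ae_iff, measure_singleton]
  filter_upwards [this] with x hx h using ⟨h.1, lt_of_le_of_ne h.2 hx⟩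

lemma _root_.AbsolutelyContinuousOnInterval.congr {f g : ℝ → ℝ}
    (hf : AbsolutelyContinuousOnInterval f a b) (h : ∀ x ∈ uIcc a b, g x = f x) :
    AbsolutelyContinuousOnInterval g a b := by
  rw [absolutelyContinuousOnInterval_iff] at *
  intro ε hε
  obtain ⟨δ, hδ, H⟩ := hf ε hε
  refine ⟨δ, hδ, fun E hE hE' => ?_⟩
  convert H E hE hE' using 2 with i hi
  rw [h _ (hE.1 i hi).1, h _ (hE.1 i hi).2]

lemma HasACDeriv.memS2 (h : HasACDeriv a b φ p) (hab : a < b)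
    (hp : IntervalIntegrable (fun x => deriv p x ^ 2) volume a b) : MemS2 a b φ where
  differentiableOn x hx := (h.hasDeriv x hx).differentiableWithinAt
  absolutelyContinuous := h.ac.congr fun x hx => by
    rw [uIcc_of_le hab.le] at hx
    exact h.derivWithin_eq hab hx
  sq_integrable := by
    refine hp.congr_ae ?_
    rw [uIoc_of_le hab.le, EventuallyEq, ae_restrict_iff' measurableSet_Ioc]
    filter_upwards [ae_mem_Ioo_of_mem_Ioc a b] with x hx hx'
    rw [h.secondDeriv_eq hab (hx hx')]

lemma HasACDeriv.integral_secondDeriv_sq (h : HasACDeriv a b φ p) (hab : a < b) :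
    ∫ x in a..b, secondDeriv a b φ x ^ 2 = ∫ x in a..b, deriv p x ^ 2 := by
  apply intervalIntegral.integral_congr_ae
  rw [uIoc_of_le hab.le]
  filter_upwards [ae_mem_Ioo_of_mem_Ioc a b] with x hx hx'
  rw [h.secondDeriv_eq hab (hx hx')]

lemma HasACDeriv.mono (h : HasACDeriv a b φ p) {c d : ℝ} (hac : a ≤ c) (hcd : c ≤ d)
    (hdb : d ≤ b) : HasACDeriv c d φ p where
  hasDeriv x hx := (h.hasDeriv x ⟨hac.trans hx.1, hx.2.trans hdb⟩).mono (Icc_subset_Icc hac hdb)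
  ac := h.ac.mono (by
    rw [uIcc_of_le hcd, uIcc_of_le (hac.trans (hcd.trans hdb))]
    exact Icc_subset_Icc hac hdb)

lemma HasACDeriv.continuousOn (h : HasACDeriv a b φ p) : ContinuousOn φ (Icc a b) :=
  fun x hx => (h.hasDeriv x hx).continuousWithinAt

lemma HasACDeriv.sub_eq_integral (h : HasACDeriv a b φ p) (hab : a ≤ b) :
    φ b - φ a = ∫ u in a..b, p u := by
  refine (intervalIntegral.integral_eq_sub_of_hasDerivAt_of_le hab h.continuousOn
    (fun x hx => (h.hasDeriv x (Ioo_subset_Icc_self hx)).hasDerivAt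
      (Icc_mem_nhds hx.1 hx.2)) ?_).symm
  exact h.ac.continuousOn.intervalIntegrable

lemma HasACDeriv.taylor (h : HasACDeriv a b φ p) (hab : a ≤ b) :
    φ b = φ a + p a * (b - a) + ∫ u in a..b, (b - u) * deriv p u := by
  have hlin : AbsolutelyContinuousOnInterval (fun u => b - u) a b := by
    refine ContDiffOn.absolutelyContinuousOnInterval ?_
    fun_prop
  have hd : ∀ u : ℝ, deriv (fun u => b - u) u = -1 := fun u => by simp
  rw [hlin.integral_mul_deriv_eq_deriv_mul h.ac]
  simp only [hd, neg_one_mul, intervalIntegral.integral_neg]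
  rw [← h.sub_eq_integral hab]
  ring

/-- Taylor expansion at `s ∈ [a, b]` with an integral remainder over the whole interval. -/
lemma HasACDeriv.taylor_indicator (h : HasACDeriv a b φ p) {s t : ℝ} (has : a ≤ s) (hst : s ≤ t)
    (htb : t ≤ b) :
    φ t = φ s + p s * (t - s) +
      ∫ u in a..b, (if s ≤ u then max (t - u) 0 else 0) * deriv p u := by
  have hint : ∀ c d, a ≤ c → c ≤ d → d ≤ b → IntervalIntegrable
      (fun u => (if s ≤ u then max (t - u) 0 else 0) * deriv p u) volume c d := by
    intro c d hac hcd hdb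
    have h1 := (h.mono hac hcd hdb).ac.intervalIntegrable_deriv
    refine (h1.norm.const_mul (|t - a|)).mono_fun ?_ ?_
    · refine AEStronglyMeasurable.mul ?_ (measurable_deriv p).aestronglyMeasurable
      refine Measurable.aestronglyMeasurable (Measurable.ite measurableSet_Ici ?_ ?_) <;> fun_prop
    · rw [uIoc_of_le hcd, EventuallyLE, ae_restrict_iff' measurableSet_Ioc]
      refine Eventually.of_forall fun u hu => ?_
      simp only [norm_mul, Real.norm_eq_abs, abs_abs]
      refine mul_le_mul_of_nonneg_right ?_ (abs_nonneg _)
      split_ifs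
      · rw [abs_of_nonneg (le_max_right (t - u) 0)]
        exact max_le ((le_abs_self _).trans' (by linarith [hu.1])) (abs_nonneg _)
      · simp
  rw [(h.mono has hst htb).taylor hst]
  congr 1
  rw [← intervalIntegral.integral_add_adjacent_intervals (b := s) (hint _ _ le_rfl has
      (hst.trans htb)) (hint _ _ has (hst.trans htb) le_rfl),
    ← intervalIntegral.integral_add_adjacent_intervals (a := s) (b := t)
      (hint _ _ has hst htb) (hint _ _ (has.trans hst) htb le_rfl)]
  have e1 : ∫ u in a..s, (if s ≤ u then max (t - u) 0 else 0) * deriv p u = 0 := by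
    apply intervalIntegral.integral_zero_ae
    rw [uIoc_of_le has]
    filter_upwards [ae_mem_Ioo_of_mem_Ioc a s] with x hx hx'
    rw [if_neg (not_le.2 (hx hx').2), zero_mul]
  have e2 : ∫ u in t..b, (if s ≤ u then max (t - u) 0 else 0) * deriv p u = 0 := by
    apply intervalIntegral.integral_zero_ae
    rw [uIoc_of_le htb]
    refine Eventually.of_forall fun x hx => ?_
    rw [max_eq_right (by linarith [hx.1])]
    simp
  rw [e1, e2, zero_add, add_zero]
  apply intervalIntegral.integral_congr
  intro u hu
  rw [uIcc_of_le hst] at hu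
  simp only [if_pos hu.1]
  rw [max_eq_left (by linarith [hu.2])]

lemma HasACDeriv.add_const_mul (h : HasACDeriv a b φ p) {φ₂ p₂ : ℝ → ℝ}
    (h₂ : HasACDeriv a b φ₂ p₂) (c : ℝ) :
    HasACDeriv a b (fun x => φ x + c * φ₂ x) (fun x => p x + c * p₂ x) where
  hasDeriv x hx := (h.hasDeriv x hx).add ((h₂.hasDeriv x hx).const_mul c)
  ac := h.ac.fun_add (h₂.ac.const_mul c)

lemma HasACDeriv.ae_deriv_add_const_mul (h : HasACDeriv a b φ p) {φ₂ p₂ : ℝ → ℝ}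
    (h₂ : HasACDeriv a b φ₂ p₂) (c : ℝ) :
    ∀ᵐ x, x ∈ uIcc a b → deriv (fun x => p x + c * p₂ x) x = deriv p x + c * deriv p₂ x := by
  filter_upwards [h.ac.ae_differentiableAt, h₂.ac.ae_differentiableAt] with x h1 h2 hx
  exact ((h1 hx).hasDerivAt.add ((h2 hx).hasDerivAt.const_mul c)).deriv

lemma intervalIntegrable_mul_of_sq {f g : ℝ → ℝ} (hf : Measurable f) (hg : Measurable g)
    (hf2 : IntervalIntegrable (fun x => f x ^ 2) volume a b)
    (hg2 : IntervalIntegrable (fun x => g x ^ 2) volume a b) :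
    IntervalIntegrable (fun x => f x * g x) volume a b := by
  refine (hf2.add hg2).mono_fun (hf.mul hg).aestronglyMeasurable (Eventually.of_forall fun x => ?_)
  simp only [Real.norm_eq_abs]
  rw [abs_of_nonneg (add_nonneg (sq_nonneg (f x)) (sq_nonneg (g x))), abs_le]
  constructor <;> nlinarith [sq_nonneg (f x + g x), sq_nonneg (f x - g x)]

lemma intervalIntegrable_sq_add_const_mul {f g : ℝ → ℝ} (hf : Measurable f) (hg : Measurable g)
    (hf2 : IntervalIntegrable (fun x => f x ^ 2) volume a b)
    (hg2 : IntervalIntegrable (fun x => g x ^ 2) volume a b) (c : ℝ) :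
    IntervalIntegrable (fun x => (f x + c * g x) ^ 2) volume a b := by
  have := (hf2.add ((intervalIntegrable_mul_of_sq hf hg hf2 hg2).const_mul (2 * c))).add
    (hg2.const_mul (c ^ 2))
  refine this.congr (fun x _ => ?_)
  ring

lemma integral_sq_add_const_mul {f g : ℝ → ℝ} (hf : Measurable f) (hg : Measurable g)
    (hf2 : IntervalIntegrable (fun x => f x ^ 2) volume a b)
    (hg2 : IntervalIntegrable (fun x => g x ^ 2) volume a b) (c : ℝ) :
    ∫ x in a..b, (f x + c * g x) ^ 2 = (∫ x in a..b, f x ^ 2)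
      + 2 * c * (∫ x in a..b, f x * g x) + c ^ 2 * ∫ x in a..b, g x ^ 2 := by
  have hfg := intervalIntegrable_mul_of_sq hf hg hf2 hg2
  rw [← intervalIntegral.integral_const_mul, ← intervalIntegral.integral_const_mul,
    ← intervalIntegral.integral_add hf2 (hfg.const_mul _),
    ← intervalIntegral.integral_add (hf2.add (hfg.const_mul _)) (hg2.const_mul _)]
  congr 1
  ext x
  ring

lemma measurable_secondDeriv (φ : ℝ → ℝ) : Measurable (secondDeriv a b φ) := measurable_deriv _

/-- `S₂[a, b]` is a vector space, on which the second derivative is linear. -/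
lemma MemS2.add_const_mul {φ₂ : ℝ → ℝ} (h : MemS2 a b φ) (h₂ : MemS2 a b φ₂) (hab : a < b)
    (c : ℝ) : MemS2 a b (fun x => φ x + c * φ₂ x) ∧
      (∀ᵐ x, x ∈ Ioc a b → secondDeriv a b (fun x => φ x + c * φ₂ x) x =
        secondDeriv a b φ x + c * secondDeriv a b φ₂ x) := by
  have H := h.hasACDeriv.add_const_mul h₂.hasACDeriv c
  have hae := h.hasACDeriv.ae_deriv_add_const_mul h₂.hasACDeriv c
  refine ⟨H.memS2 hab ?_, ?_⟩
  · refine (intervalIntegrable_sq_add_const_mul (measurable_secondDeriv φ)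
      (measurable_secondDeriv φ₂) h.sq_integrable h₂.sq_integrable c).congr_ae ?_
    rw [uIoc_of_le hab.le, EventuallyEq, ae_restrict_iff' measurableSet_Ioc]
    filter_upwards [hae] with x hx hx'
    rw [hx (by rw [uIcc_of_le hab.le]; exact Ioc_subset_Icc_self hx')]
    rfl
  · filter_upwards [hae, ae_mem_Ioo_of_mem_Ioc a b] with x hx h1 hx'
    rw [H.secondDeriv_eq hab (h1 hx'),
      hx (by rw [uIcc_of_le hab.le]; exact Ioc_subset_Icc_self hx')]
    rfl

end Taylor

/-! ### Smoothing splines: Euler-Lagrange equation and score identity. -/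

section Spline

variable {n : ℕ} {t y : Fin n → ℝ} {μ : ℝ} {ψ : ℝ → ℝ}

lemma lo_le (t : Fin n → ℝ) (i : Fin n) : lo t ≤ t i := ciInf_le (Set.finite_range t).bddBelow i

lemma le_hi (t : Fin n → ℝ) (i : Fin n) : t i ≤ hi t := le_ciSup (Set.finite_range t).bddAbove i

lemma eq_zero_of_forall_quadratic_nonneg {B C : ℝ} (h : ∀ τ : ℝ, 0 ≤ τ * B + τ ^ 2 * C) :
    B = 0 := by
  by_contra hB
  have hC : 0 < |C| + 1 := by positivity
  -- Near `τ = 0` the linear term dominates; the `+ 1` keeps the step finite when `C = 0`.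
  have := h (-B / (|C| + 1))
  have e : -B / (|C| + 1) * B + (-B / (|C| + 1)) ^ 2 * C
      = B ^ 2 * (C - (|C| + 1)) / (|C| + 1) ^ 2 := by
    field_simp
    ring
  rw [e] at this
  have h2 : B ^ 2 * (C - (|C| + 1)) / (|C| + 1) ^ 2 < 0 := by
    apply div_neg_of_neg_of_pos _ (by positivity)
    have : 0 < B ^ 2 := by positivity
    nlinarith [le_abs_self C]
  linarith

/-- The Euler-Lagrange equation of the smoothing spline. -/
lemma IsSmoothingSpline.euler_lagrange (h : IsSmoothingSpline t y μ ψ) (hab : lo t < hi t)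
    {φ : ℝ → ℝ} (hφ : MemS2 (lo t) (hi t) φ) :
    (n : ℝ)⁻¹ * ∑ i, (y i - ψ (t i)) * φ (t i) =
      μ * ∫ x in (lo t)..(hi t), secondDeriv (lo t) (hi t) ψ x * secondDeriv (lo t) (hi t) φ x := by
  set a := lo t
  set b := hi t
  -- Along `ψ + τ φ` the criterion is a quadratic polynomial in `τ` with its minimum at `τ = 0`, so
  -- its linear coefficient vanishes.
  have key : ∀ τ : ℝ, 0 ≤ τ * (2 * (μ * (∫ x in a..b, secondDeriv a b ψ x * secondDeriv a b φ x)
      - (n : ℝ)⁻¹ * ∑ i, (y i - ψ (t i)) * φ (t i))) + τ ^ 2 *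
      ((n : ℝ)⁻¹ * ∑ i, φ (t i) ^ 2 + μ * ∫ x in a..b, secondDeriv a b φ x ^ 2) := by
    intro τ
    obtain ⟨hm, hae⟩ := h.1.add_const_mul hφ hab τ
    have h1 := h.2 _ hm
    have h2 : ∫ x in a..b, secondDeriv a b (fun x => ψ x + τ * φ x) x ^ 2 =
        ∫ x in a..b, (secondDeriv a b ψ x + τ * secondDeriv a b φ x) ^ 2 := by
      apply intervalIntegral.integral_congr_ae
      rw [uIoc_of_le hab.le]
      filter_upwards [hae] with x hx hx'
      rw [hx hx']
    rw [splineCriterion, splineCriterion, h2, integral_sq_add_const_mul (measurable_secondDeriv ψ)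
      (measurable_secondDeriv φ) h.1.sq_integrable hφ.sq_integrable] at h1
    have h3 : ∑ i, (y i - (ψ (t i) + τ * φ (t i))) ^ 2 = ∑ i, (y i - ψ (t i)) ^ 2
        - 2 * τ * ∑ i, (y i - ψ (t i)) * φ (t i) + τ ^ 2 * ∑ i, φ (t i) ^ 2 := by
      rw [Finset.mul_sum, Finset.mul_sum, ← Finset.sum_sub_distrib, ← Finset.sum_add_distrib]
      exact Finset.sum_congr rfl fun i _ => by ring
    rw [h3] at h1
    linarith
  have := eq_zero_of_forall_quadratic_nonneg key
  linarith

lemma memS2_affine {a b : ℝ} (hab : a < b) (c d : ℝ) : MemS2 a b (fun x => c + d * x) ∧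
    ∀ x ∈ Ioo a b, secondDeriv a b (fun x => c + d * x) x = 0 := by
  have h : HasACDeriv a b (fun x => c + d * x) (fun _ => d) :=
    ⟨fun x _ => (((hasDerivAt_id x).const_mul d).const_add c).hasDerivWithinAt.congr_deriv
      (by simp), ContDiffOn.absolutelyContinuousOnInterval contDiffOn_const⟩
  exact ⟨h.memS2 hab (by simp), fun x hx => by rw [h.secondDeriv_eq hab hx, deriv_const]⟩

/-- Affine functions carry no penalty, so the right side of the Euler-Lagrange equation vanishes for
them. -/
lemma IsSmoothingSpline.sum_residual_affine (h : IsSmoothingSpline t y μ ψ) (hab : lo t < hi t)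
    (c d : ℝ) : (n : ℝ)⁻¹ * ∑ i, (y i - ψ (t i)) * (c + d * t i) = 0 := by
  obtain ⟨h1, h2⟩ := memS2_affine hab c d
  rw [h.euler_lagrange hab h1]
  rw [intervalIntegral.integral_zero_ae, mul_zero]
  rw [uIoc_of_le hab.le]
  filter_upwards [ae_mem_Ioo_of_mem_Ioc (lo t) (hi t)] with x hx hx'
  rw [h2 x (hx hx'), mul_zero]

/-- `u ↦ n⁻¹ ∑ (yᵢ - ψ(tᵢ)) (tᵢ - u)₊`. -/
def residualKernel (t y : Fin n → ℝ) (ψ : ℝ → ℝ) (u : ℝ) : ℝ :=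
  (n : ℝ)⁻¹ * ∑ i, (y i - ψ (t i)) * max (t i - u) 0

lemma continuous_residualKernel : Continuous (residualKernel t y ψ) := by
  unfold residualKernel
  fun_prop

/-- Continuity of the kernel is not enough: the score identity differentiates it and integrates the
derivative back. -/
lemma residualKernel_ac (a b : ℝ) :
    AbsolutelyContinuousOnInterval (residualKernel t y ψ) a b := by
  have h1 : ∀ c : ℝ, AbsolutelyContinuousOnInterval (fun u => max (c - u) 0) a b := by
    intro c
    have : LipschitzWith 1 (fun u : ℝ => max (c - u) 0) := by
      refine LipschitzWith.of_dist_le_mul fun x z => ?_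
      rw [Real.dist_eq, Real.dist_eq, NNReal.coe_one, one_mul]
      refine (abs_max_sub_max_le_abs _ _ _).trans (le_of_eq ?_)
      rw [abs_sub_comm]
      congr 1
      ring
    exact this.lipschitzOnWith.absolutelyContinuousOnInterval
  have h2 : ∀ s : Finset (Fin n), AbsolutelyContinuousOnInterval
      (fun u => ∑ i ∈ s, (y i - ψ (t i)) * max (t i - u) 0) a b := by
    intro s
    induction s using Finset.induction_on with
    | empty => simpa using ContDiffOn.absolutelyContinuousOnInterval (contDiffOn_const (c := (0 : ℝ)))
    | insert i s hi ih =>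
      simp only [Finset.sum_insert hi]
      exact ((h1 _).const_mul _).fun_add ih
  exact (h2 _).const_mul _

/-- Expand `φ` at the left end point: the affine part is orthogonal to the residuals, and the
remainders add up to the kernel integrated against `φ''`. -/
lemma IsSmoothingSpline.sum_residual_eq_integral (h : IsSmoothingSpline t y μ ψ)
    (hab : lo t < hi t) {φ p : ℝ → ℝ} (hφ : HasACDeriv (lo t) (hi t) φ p) :
    (n : ℝ)⁻¹ * ∑ i, (y i - ψ (t i)) * φ (t i) =
      ∫ u in (lo t)..(hi t), residualKernel t y ψ u * deriv p u := by
  set a := lo t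
  set b := hi t
  have h1 : ∀ i, φ (t i) = (φ a - p a * a + p a * t i) +
      ∫ u in a..b, max (t i - u) 0 * deriv p u := by
    intro i
    rw [hφ.taylor_indicator le_rfl (lo_le t i) (le_hi t i)]
    have : ∫ u in a..b, (if a ≤ u then max (t i - u) 0 else 0) * deriv p u =
        ∫ u in a..b, max (t i - u) 0 * deriv p u := by
      apply intervalIntegral.integral_congr
      intro u hu
      rw [uIcc_of_le hab.le] at hu
      simp only [if_pos hu.1]
    rw [this]
    ring
  have hint : ∀ i, IntervalIntegrable (fun u => max (t i - u) 0 * deriv p u) volume a b :=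
    fun i => hφ.ac.intervalIntegrable_deriv.continuousOn_mul (by fun_prop)
  have h2 : ∫ u in a..b, residualKernel t y ψ u * deriv p u =
      (n : ℝ)⁻¹ * ∑ i, (y i - ψ (t i)) * ∫ u in a..b, max (t i - u) 0 * deriv p u := by
    simp only [← intervalIntegral.integral_const_mul]
    rw [← intervalIntegral.integral_finsetSum fun i _ => (hint i).const_mul _,
      ← intervalIntegral.integral_const_mul]
    congr 1
    ext u
    rw [residualKernel, mul_assoc, Finset.sum_mul]
    simp only [mul_assoc]
  have h3 := h.sum_residual_affine hab (φ a - p a * a) (p a)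
  rw [h2]
  refine sub_eq_zero.1 (Eq.trans ?_ h3)
  rw [← mul_sub, ← Finset.sum_sub_distrib]
  congr 1
  refine Finset.sum_congr rfl fun i _ => ?_
  rw [h1 i]
  ring

/-- The second derivative of the smoothing spline is continuous and piecewise linear. -/
lemma IsSmoothingSpline.secondDeriv_ae_eq (h : IsSmoothingSpline t y μ ψ) (hab : lo t < hi t) :
    ∀ᵐ x, x ∈ Ioc (lo t) (hi t) →
      μ * secondDeriv (lo t) (hi t) ψ x = residualKernel t y ψ x := by
  set a := lo t
  set b := hi t
  set v := residualKernel t y ψ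
  have hv : Continuous v := continuous_residualKernel
  have hV1 : ∀ x, HasDerivAt (fun x => ∫ u in a..x, v u) (v x) x := fun x =>
    (hv.integral_hasStrictDerivAt a x).hasDerivAt
  have hV1c : Continuous (fun x => ∫ u in a..x, v u) :=
    continuous_iff_continuousAt.2 fun x => (hV1 x).continuousAt
  have hV : ∀ x, HasDerivAt (fun x => ∫ s in a..x, ∫ u in a..s, v u) (∫ u in a..x, v u) x :=
    fun x => (hV1c.integral_hasStrictDerivAt a x).hasDerivAt
  set V1 := fun x => ∫ u in a..x, v u
  set V := fun x => ∫ s in a..x, V1 s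
  have hd : deriv V1 = v := funext fun x => (hV1 x).deriv
  have hVac : HasACDeriv a b V V1 := by
    refine ⟨fun x _ => (hV x).hasDerivWithinAt, ?_⟩
    refine ContDiffOn.absolutelyContinuousOnInterval (ContDiff.contDiffOn ?_)
    rw [contDiff_one_iff_deriv]
    exact ⟨fun x => (hV1 x).differentiableAt, by rwa [hd]⟩
  have hVm : MemS2 a b V := hVac.memS2 hab (by
    rw [hd]; exact (hv.pow 2).intervalIntegrable _ _)
  -- `V` is a second primitive of `v`, so the test function `V - μ ψ` has second derivative `v - μ
  -- ψ''`. The two expressions for the residual sum say that `v - μ ψ''` is orthogonal to this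
  -- function, that is, to itself.
  obtain ⟨hm0, hae0⟩ := (hVm.add_const_mul h.1 hab (-μ))
  have e1 := h.euler_lagrange hab hm0
  rw [h.sum_residual_eq_integral hab hm0.hasACDeriv] at e1
  have hi1 : IntervalIntegrable (fun x => v x * secondDeriv a b (fun x => V x + -μ * ψ x) x)
      volume a b :=
    intervalIntegrable_mul_of_sq hv.measurable (measurable_secondDeriv _)
      ((hv.pow 2).intervalIntegrable _ _) hm0.sq_integrable
  have hi2 : IntervalIntegrable (fun x => secondDeriv a b ψ x *
      secondDeriv a b (fun x => V x + -μ * ψ x) x) volume a b :=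
    intervalIntegrable_mul_of_sq (measurable_secondDeriv _) (measurable_secondDeriv _)
      h.1.sq_integrable hm0.sq_integrable
  have hsd : ∀ᵐ x, x ∈ Ioc a b → secondDeriv a b (fun x => V x + -μ * ψ x) x =
      v x - μ * secondDeriv a b ψ x := by
    filter_upwards [hae0, ae_mem_Ioo_of_mem_Ioc a b] with x hx h1 hx'
    rw [hx hx', hVac.secondDeriv_eq hab (h1 hx'), hd]
    ring
  have e2 : ∫ x in a..b, secondDeriv a b (fun x => V x + -μ * ψ x) x ^ 2 = 0 := by
    have : ∫ x in a..b, (v x * secondDeriv a b (fun x => V x + -μ * ψ x) x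
        - μ * (secondDeriv a b ψ x * secondDeriv a b (fun x => V x + -μ * ψ x) x)) = 0 := by
      rw [intervalIntegral.integral_sub hi1 (hi2.const_mul μ),
        intervalIntegral.integral_const_mul, ← e1]
      exact sub_self _
    rw [← this]
    apply intervalIntegral.integral_congr_ae
    rw [uIoc_of_le hab.le]
    filter_upwards [hsd] with x hx hx'
    rw [hx hx']
    ring
  rw [intervalIntegral.integral_of_le hab.le, integral_eq_zero_iff_of_nonneg
    (fun x => sq_nonneg _) ((intervalIntegrable_iff_integrableOn_Ioc_of_le hab.le).1
      hm0.sq_integrable), EventuallyEq, ae_restrict_iff' measurableSet_Ioc] at e2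
  filter_upwards [e2, hsd] with x h1 h2 hx
  have := h1 hx
  rw [h2 hx] at this
  simp only [Pi.zero_apply, ne_eq, OfNat.ofNat_ne_zero, not_false_eq_true, pow_eq_zero_iff] at this
  linarith

/-- Score identity: testing the Euler-Lagrange equation with `H ψ'` bounds the weighted score
by the penalty parameter. -/
theorem IsSmoothingSpline.abs_score_le (h : IsSmoothingSpline t y μ ψ) (hab : lo t < hi t)
    (hμ : 0 < μ) {H K : ℝ → ℝ} {L : NNReal} {C M : ℝ}
    (hH : ∀ x ∈ Icc (lo t) (hi t), HasDerivWithinAt H (K x) (Icc (lo t) (hi t)) x)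
    (hK : LipschitzOnWith L K (Icc (lo t) (hi t)))
    (hC : ∀ x ∈ Icc (lo t) (hi t), |K x| ≤ C)
    (hM : ∀ x ∈ Icc (lo t) (hi t), |derivWithin ψ (Icc (lo t) (hi t)) x| ≤ M) :
    |(n : ℝ)⁻¹ * ∑ i, (y i - ψ (t i)) *
        (H (t i) * derivWithin ψ (Icc (lo t) (hi t)) (t i))| ≤
      μ * (L * M * (hi t - lo t) + (L * M + 2 * C) *
        ∫ x in (lo t)..(hi t), secondDeriv (lo t) (hi t) ψ x ^ 2) := by
  have hsd := h.secondDeriv_ae_eq hab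
  have hbd : ∀ i, t i ∈ Icc (lo t) (hi t) := fun i => ⟨lo_le t i, le_hi t i⟩
  have haff := h.sum_residual_affine hab
  have hsum := fun {φ p : ℝ → ℝ} => h.sum_residual_eq_integral hab (φ := φ) (p := p)
  have hψ := h.1.hasACDeriv
  set a := lo t
  set b := hi t
  set v := residualKernel t y ψ with hv_def
  set D := derivWithin ψ (Icc a b) with hD_def
  -- The continuous representative of `ψ''`.
  set w : ℝ → ℝ := fun x => μ⁻¹ * v x with hw
  have hvc : Continuous v := continuous_residualKernel
  have hwc : Continuous w := continuous_const.mul hvc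
  -- Natural boundary conditions: `v a` is the residual sum against the affine function `t - a`,
  -- while at `b` every positive part vanishes.
  have hva : v a = 0 := by
    have := haff (-a) 1
    rw [hv_def, residualKernel, ← this]
    congr 1
    refine Finset.sum_congr rfl fun i _ => ?_
    rw [max_eq_left (by linarith [(hbd i).1])]
    ring
  have hvb : v b = 0 := by
    rw [hv_def, residualKernel, Finset.sum_eq_zero, mul_zero]
    intro i _
    rw [max_eq_right (by linarith [(hbd i).2]), mul_zero]
  have hwac : AbsolutelyContinuousOnInterval w a b := (residualKernel_ac a b).const_mul _
  have hsw : ∀ᵐ x, x ∈ Ioc a b → deriv D x = w x := by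
    filter_upwards [hsd] with x hx hx'
    have := hx hx'
    simp only [hw]
    rw [← this, ← mul_assoc, inv_mul_cancel₀ hμ.ne', one_mul]
    rfl
  have hDeq : ∀ x ∈ Icc a b, D x = D a + ∫ u in a..x, w u := by
    intro x hx
    have h1 := (hψ.mono le_rfl hx.1 hx.2).ac.integral_deriv_eq_sub
    have h2 : ∫ u in a..x, deriv D u = ∫ u in a..x, w u := by
      apply intervalIntegral.integral_congr_ae
      rw [uIoc_of_le hx.1]
      filter_upwards [hsw] with u hu hu'
      exact hu ⟨hu'.1, hu'.2.trans hx.2⟩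
    rw [← h2, h1]
    ring
  -- `ψ'` is the integral of the continuous `w`, so it is differentiable at every point of the
  -- interval. This makes `H ψ'` an admissible test function.
  have hD : ∀ x ∈ Icc a b, HasDerivWithinAt D (w x) (Icc a b) x := by
    intro x hx
    have h1 : HasDerivAt (fun x => D a + ∫ u in a..x, w u) (w x) x :=
      (hwc.integral_hasStrictDerivAt a x).hasDerivAt.const_add _
    exact h1.hasDerivWithinAt.congr hDeq (hDeq x hx)
  have hIcc : uIcc a b = Icc a b := uIcc_of_le hab.le
  have hHac : AbsolutelyContinuousOnInterval H a b := by
    have : LipschitzOnWith C.toNNReal H (Icc a b) := by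
      refine (convex_Icc a b).lipschitzOnWith_of_nnnorm_hasDerivWithin_le hH fun x hx => ?_
      rw [← NNReal.coe_le_coe, coe_nnnorm, Real.norm_eq_abs]
      exact (hC x hx).trans (Real.le_coe_toNNReal C)
    exact (this.mono hIcc.le).absolutelyContinuousOnInterval
  have hKac : AbsolutelyContinuousOnInterval K a b :=
    (hK.mono hIcc.le).absolutelyContinuousOnInterval
  have hDac := hψ.ac
  have hφ : HasACDeriv a b (fun x => H x * D x) (fun x => K x * D x + H x * w x) :=
    ⟨fun x hx => (hH x hx).mul (hD x hx), (hKac.fun_mul hDac).fun_add (hHac.fun_mul hwac)⟩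
  have hFac : AbsolutelyContinuousOnInterval (fun x => H x * (w x * w x)) a b :=
    hHac.fun_mul (hwac.fun_mul hwac)
  have hF0 := hFac.integral_deriv_eq_sub
  have hwa : w a = 0 := by simp [hw, hva]
  have hwb : w b = 0 := by simp [hw, hvb]
  simp only [hwa, hwb, mul_zero, sub_zero] at hF0
  rw [hsum hφ]
  have hvw : ∀ x, v x = μ * w x := fun x => by
    simp only [hw]; rw [← mul_assoc, mul_inv_cancel₀ hμ.ne', one_mul]
  have hi1 : IntervalIntegrable (fun u => w u * deriv (fun x => K x * D x + H x * w x) u)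
    volume a b := hφ.ac.intervalIntegrable_deriv.continuousOn_mul hwc.continuousOn
  -- Subtracting half the derivative of `H w²` costs nothing, because `w` vanishes at both ends; it
  -- serves to cancel the term `H w w'`.
  have e1 : ∫ u in a..b, v u * deriv (fun x => K x * D x + H x * w x) u =
      μ * ∫ u in a..b, (w u * deriv (fun x => K x * D x + H x * w x) u
        - 1 / 2 * deriv (fun x => H x * (w x * w x)) u) := by
    rw [intervalIntegral.integral_sub hi1 (hFac.intervalIntegrable_deriv.const_mul _),
      intervalIntegral.integral_const_mul, hF0, mul_zero, sub_zero,
      ← intervalIntegral.integral_const_mul]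
    simp only [hvw, mul_assoc]
  have e2 : ∫ x in a..b, secondDeriv a b ψ x ^ 2 = ∫ x in a..b, w x ^ 2 := by
    apply intervalIntegral.integral_congr_ae
    rw [uIoc_of_le hab.le]
    filter_upwards [hsw] with x hx hx'
    rw [← hx hx']
    rfl
  rw [e1, e2, abs_mul, abs_of_pos hμ]
  refine mul_le_mul_of_nonneg_left ?_ hμ.le
  have hM0 : 0 ≤ M := (abs_nonneg _).trans (hM a (left_mem_Icc.2 hab.le))
  have hC0 : 0 ≤ C := (abs_nonneg _).trans (hC a (left_mem_Icc.2 hab.le))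
  have hi3 : IntervalIntegrable (fun u => (L * M : ℝ) + (L * M + 2 * C) * w u ^ 2) volume a b :=
    Continuous.intervalIntegrable (by fun_prop) _ _
  have e3 : ∫ u in a..b, ((L * M : ℝ) + (L * M + 2 * C) * w u ^ 2) =
      L * M * (b - a) + (L * M + 2 * C) * ∫ x in a..b, w x ^ 2 := by
    rw [intervalIntegral.integral_add (by simp) (Continuous.intervalIntegrable (by fun_prop) _ _),
      intervalIntegral.integral_const, intervalIntegral.integral_const_mul (L * M + 2 * C : ℝ),
      smul_eq_mul]
    ring
  rw [← e3, ← Real.norm_eq_abs]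
  refine intervalIntegral.norm_integral_le_of_norm_le hab.le ?_ hi3
  filter_upwards [ae_mem_Ioo_of_mem_Ioc a b, hKac.ae_differentiableAt, hwac.ae_differentiableAt]
    with x hx1 hx2 hx3 hx
  have hxo := hx1 hx
  have hxc : x ∈ Icc a b := Ioc_subset_Icc_self hx
  have hnh := Icc_mem_nhds hxo.1 hxo.2
  have dK := (hx2 (hIcc ▸ hxc)).hasDerivAt
  have dw := (hx3 (hIcc ▸ hxc)).hasDerivAt
  have dH := (hH x hxc).hasDerivAt hnh
  have dD := (hD x hxc).hasDerivAt hnh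
  have hKL : |deriv K x| ≤ L := norm_deriv_le_of_lipschitzOn hnh hK
  have hDM := hM x hxc
  have hKC := hC x hxc
  have d1 := ((dK.mul dD).add (dH.mul dw)).deriv
  have d2 := (dH.mul (dw.mul dw)).deriv
  change deriv (fun x => K x * D x + H x * w x) x = _ at d1
  change deriv (fun x => H x * (w x * w x)) x = _ at d2
  rw [d1, d2, Real.norm_eq_abs]
  -- All terms with `w'` cancel, so the values of `H` itself do not enter the bound.
  have e4 : w x * (deriv K x * D x + K x * w x + (K x * w x + H x * deriv w x)) -
      1 / 2 * (K x * (w x * w x) + H x * (deriv w x * w x + w x * deriv w x)) =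
      w x * (deriv K x * D x) + (3 / 2) * (K x * w x ^ 2) := by ring
  simp only [Pi.mul_apply]
  rw [e4]
  have b1 : |deriv K x * D x| ≤ L * M := by
    rw [abs_mul]
    exact mul_le_mul hKL hDM (abs_nonneg _) L.2
  have b2 : |w x| ≤ 1 + w x ^ 2 := by
    rw [abs_le]; constructor <;> nlinarith [sq_nonneg (w x + 1), sq_nonneg (w x - 1)]
  have b3 : |w x * (deriv K x * D x)| ≤ (1 + w x ^ 2) * (L * M) := by
    rw [abs_mul]
    exact mul_le_mul b2 b1 (abs_nonneg _) (by positivity)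
  have b4 : |K x * w x ^ 2| ≤ C * w x ^ 2 := by
    rw [abs_mul, abs_of_nonneg (sq_nonneg (w x))]
    exact mul_le_mul_of_nonneg_right hKC (sq_nonneg _)
  calc _ ≤ |w x * (deriv K x * D x)| + |3 / 2 * (K x * w x ^ 2)| := abs_add_le _ _
    _ ≤ (1 + w x ^ 2) * (L * M) + 3 / 2 * (C * w x ^ 2) := by
      rw [abs_mul (3 / 2 : ℝ), abs_of_pos (by norm_num : (0 : ℝ) < 3 / 2)]
      gcongr
    _ ≤ _ := by nlinarith [mul_nonneg hC0 (sq_nonneg (w x))]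

end Spline

/-! ### A deterministic bound for the noise functional, by cells. -/

section NoiseInequality

variable {n : ℕ}

/-- Cauchy-Schwarz from the discriminant of the nonnegative quadratic `c ↦ ∫ (f + c g)²`. -/
lemma sq_integral_mul_le {a b : ℝ} (hab : a ≤ b) {f g : ℝ → ℝ} (hf : Measurable f)
    (hg : Measurable g) (hf2 : IntervalIntegrable (fun x => f x ^ 2) volume a b)
    (hg2 : IntervalIntegrable (fun x => g x ^ 2) volume a b) :
    (∫ x in a..b, f x * g x) ^ 2 ≤ (∫ x in a..b, f x ^ 2) * ∫ x in a..b, g x ^ 2 := by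
  have h : ∀ c : ℝ, 0 ≤ (∫ x in a..b, g x ^ 2) * (c * c) + (2 * ∫ x in a..b, f x * g x) * c
      + ∫ x in a..b, f x ^ 2 := by
    intro c
    have h1 := integral_sq_add_const_mul hf hg hf2 hg2 c
    have h2 : 0 ≤ ∫ x in a..b, (f x + c * g x) ^ 2 :=
      intervalIntegral.integral_nonneg hab fun x _ => sq_nonneg _
    linarith
  have := discrim_le_zero h
  rw [discrim] at this
  linarith

/-- Orthogonal expansion of an affine function in the constant and the centered linear function. -/
lemma sq_sum_mul_affine_le {ι : Type*} (s : Finset ι) (e t : ι → ℝ) (c d m S : ℝ)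
    (hm : m = (∑ i ∈ s, t i) / (s.card : ℝ)) (hS : S = ∑ i ∈ s, (t i - m) ^ 2) :
    (∑ i ∈ s, e i * (c + d * t i)) ^ 2 ≤
      ((∑ i ∈ s, e i * (1 / √(s.card : ℝ))) ^ 2 + (∑ i ∈ s, e i * ((t i - m) / √S)) ^ 2) *
        ∑ i ∈ s, (c + d * t i) ^ 2 := by
  rcases s.eq_empty_or_nonempty with rfl | hs
  · simp
  have hN : (0 : ℝ) < s.card := by exact_mod_cast hs.card_pos
  set N : ℝ := (s.card : ℝ) with hNdef
  have hS0 : 0 ≤ S := hS ▸ Finset.sum_nonneg fun i _ => sq_nonneg _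
  have hcent : ∑ i ∈ s, (t i - m) = 0 := by
    rw [Finset.sum_sub_distrib, Finset.sum_const, nsmul_eq_mul, hm]
    field_simp
    simp [hNdef]
  have h1 : ∑ i ∈ s, (c + d * t i) ^ 2 = (c + d * m) ^ 2 * N + d ^ 2 * S := by
    have : ∀ i ∈ s, (c + d * t i) ^ 2 =
        (c + d * m) ^ 2 + 2 * (c + d * m) * d * (t i - m) + d ^ 2 * (t i - m) ^ 2 :=
      fun i _ => by ring
    rw [Finset.sum_congr rfl this, Finset.sum_add_distrib, Finset.sum_add_distrib,
      ← Finset.mul_sum, ← Finset.mul_sum, hcent, ← hS, Finset.sum_const, nsmul_eq_mul]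
    ring
  have h2 : ∑ i ∈ s, e i * (c + d * t i) =
      (c + d * m) * ∑ i ∈ s, e i + d * ∑ i ∈ s, e i * (t i - m) := by
    rw [Finset.mul_sum, Finset.mul_sum, ← Finset.sum_add_distrib]
    exact Finset.sum_congr rfl fun i _ => by ring
  have h3 : ∑ i ∈ s, e i * (1 / √N) = (∑ i ∈ s, e i) / √N := by
    rw [← Finset.sum_mul]; ring
  have h4 : ∑ i ∈ s, e i * ((t i - m) / √S) = (∑ i ∈ s, e i * (t i - m)) / √S := by
    rw [Finset.sum_div]
    exact Finset.sum_congr rfl fun i _ => by ring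
  -- If the scatter is zero, division by `√S` yields zero, but then every `t i` equals the mean and
  -- both sides vanish.
  have h5 : ∑ i ∈ s, e i * (t i - m) = √S * ((∑ i ∈ s, e i * (t i - m)) / √S) := by
    rcases hS0.eq_or_lt with h0 | h0
    · have : ∀ i ∈ s, t i - m = 0 := by
        rw [← h0] at hS
        have := (Finset.sum_eq_zero_iff_of_nonneg fun i _ => sq_nonneg (t i - m)).1 hS.symm
        exact fun i hi => by simpa using this i hi
      rw [Finset.sum_eq_zero fun i hi => by rw [this i hi, mul_zero]]
      simp
    · rw [mul_div_cancel₀ _ (Real.sqrt_pos.2 h0).ne']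
  have h6 : ∑ i ∈ s, e i = √N * ((∑ i ∈ s, e i) / √N) := by
    rw [mul_div_cancel₀ _ (Real.sqrt_pos.2 hN).ne']
  have h7 : ∑ i ∈ s, e i * (c + d * t i) = (c + d * m) * (√N * ((∑ i ∈ s, e i) / √N)) +
      d * (√S * ((∑ i ∈ s, e i * (t i - m)) / √S)) := by rw [h2, ← h6, ← h5]
  rw [h3, h4, h1, h7]
  generalize (∑ i ∈ s, e i) / √N = x
  generalize (∑ i ∈ s, e i * (t i - m)) / √S = z
  have e1 : √N ^ 2 = N := Real.sq_sqrt hN.le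
  have e2 : √S ^ 2 = S := Real.sq_sqrt hS0
  -- Lagrange's identity: the gap in the two-dimensional Cauchy-Schwarz inequality is a square.
  have : ((x ^ 2 + z ^ 2) * ((c + d * m) ^ 2 * √N ^ 2 + d ^ 2 * √S ^ 2)) -
      ((c + d * m) * (√N * x) + d * (√S * z)) ^ 2 =
      (x * d * √S - z * (c + d * m) * √N) ^ 2 := by ring
  rw [e1, e2] at this
  nlinarith [sq_nonneg (x * d * √S - z * (c + d * m) * √N)]

/-- The index of the cell `[A + q h, A + (q + 1) h)` that contains `x`. -/
def cell (A h x : ℝ) : ℕ := ⌊(x - A) / h⌋₊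

lemma cell_le {A h x : ℝ} (hh : 0 < h) (hx : A ≤ x) : A + cell A h x * h ≤ x := by
  have := Nat.floor_le (div_nonneg (sub_nonneg.2 hx) hh.le)
  rw [le_div_iff₀ hh] at this
  unfold cell
  linarith

lemma lt_cell_add {A h x : ℝ} (hh : 0 < h) : x < A + cell A h x * h + h := by
  have := Nat.lt_floor_add_one ((x - A) / h)
  rw [div_lt_iff₀ hh] at this
  unfold cell
  linarith

lemma cell_eq {A h x u : ℝ} (hh : 0 < h) (h1 : A + cell A h x * h ≤ u) (h2 : u ≤ x) :
    cell A h u = cell A h x := by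
  apply le_antisymm
  · exact Nat.floor_le_floor (by gcongr)
  · apply Nat.le_floor
    rw [le_div_iff₀ hh]
    linarith

lemma measurable_cell (A h : ℝ) : Measurable (cell A h) :=
  Nat.measurable_floor.comp ((measurable_id.sub_const A).div_const h)

/-- `(x - u)₊` for `u` in or to the right of the cell of `x`. -/
def cellKernel (A h x u : ℝ) : ℝ := if A + cell A h x * h ≤ u then max (x - u) 0 else 0

lemma measurable_cellKernel {β : Type*} [MeasurableSpace β] (A h : ℝ) {f g : β → ℝ}
    (hf : Measurable f) (hg : Measurable g) : Measurable fun z => cellKernel A h (f z) (g z) := by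
  have h1 : Measurable fun n : ℕ => (n : ℝ) := measurable_from_top
  have h2 : Measurable fun z => cell A h (f z) := (measurable_cell A h).comp hf
  have h3 : Measurable fun z => A + (cell A h (f z) : ℝ) * h :=
    ((h1.comp h2).mul_const h).const_add A
  unfold cellKernel
  refine Measurable.ite (measurableSet_le h3 hg) ?_ measurable_const
  fun_prop

lemma cellKernel_nonneg (A h x u : ℝ) : 0 ≤ cellKernel A h x u := by
  unfold cellKernel; split_ifs
  · exact le_max_right _ _
  · rfl

lemma cellKernel_le {A h x u : ℝ} (hh : 0 < h) : cellKernel A h x u ≤ h := by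
  unfold cellKernel; split_ifs with h1
  · exact max_le (by linarith [lt_cell_add (A := A) (x := x) hh]) hh.le
  · exact hh.le

lemma cellKernel_eq_zero {A h x u : ℝ} (hh : 0 < h)
    (hu : u ∉ Icc (A + cell A h x * h) (A + cell A h x * h + h)) : cellKernel A h x u = 0 := by
  unfold cellKernel; split_ifs with h1
  · apply max_eq_right
    by_contra h2
    exact hu ⟨h1, by linarith [lt_cell_add (A := A) (x := x) hh]⟩
  · rfl

/-- A nonzero value forces `u` to lie between the left end of the cell of `x` and `x`. This locality
lets each Taylor remainder be charged to the roughness on its own cell. -/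
lemma cellKernel_eq_zero_of_cell_ne {A h x u : ℝ} (hh : 0 < h) (hu : cell A h u ≠ cell A h x) :
    cellKernel A h x u = 0 := by
  unfold cellKernel; split_ifs with h1
  · apply max_eq_right
    by_contra h2
    exact hu (cell_eq hh h1 (by linarith))
  · rfl

lemma cellKernel_sq_le (A x u : ℝ) {h : ℝ} (hh : 0 < h) : cellKernel A h x u ^ 2 ≤
    (Icc (A + cell A h x * h) (A + cell A h x * h + h)).indicator (fun _ => h ^ 2) u := by
  by_cases hu : u ∈ Icc (A + cell A h x * h) (A + cell A h x * h + h)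
  · rw [indicator_of_mem hu]
    exact pow_le_pow_left₀ (cellKernel_nonneg _ _ _ _) (cellKernel_le hh) 2
  · rw [indicator_of_notMem hu, cellKernel_eq_zero hh hu]
    simp

lemma measurable_cellKernel_right (A h x : ℝ) : Measurable (cellKernel A h x) :=
  measurable_cellKernel A h measurable_const measurable_id

lemma intervalIntegrable_cellKernel_sq (A x a b : ℝ) {h : ℝ} (hh : 0 < h) :
    IntervalIntegrable (fun u => cellKernel A h x u ^ 2) volume a b := by
  refine (intervalIntegrable_const (c := h ^ 2)).mono_fun
    ((measurable_cellKernel_right A h x).pow_const 2).aestronglyMeasurable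
    (Eventually.of_forall fun u => ?_)
  simp only
  rw [Real.norm_of_nonneg (sq_nonneg _), Real.norm_of_nonneg (sq_nonneg _)]
  exact pow_le_pow_left₀ (cellKernel_nonneg _ _ _ _) (cellKernel_le hh) 2

lemma lintegral_cellKernel_sq_le (A x : ℝ) {h : ℝ} (hh : 0 < h) (s : Set ℝ) :
    ∫⁻ u in s, ENNReal.ofReal (cellKernel A h x u ^ 2) ≤ ENNReal.ofReal (h ^ 3) := by
  calc _ ≤ ∫⁻ u, ENNReal.ofReal (cellKernel A h x u ^ 2) := setLIntegral_le_lintegral _ _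
    _ ≤ ∫⁻ u, (Icc (A + cell A h x * h) (A + cell A h x * h + h)).indicator
        (fun _ => ENNReal.ofReal (h ^ 2)) u := by
      refine lintegral_mono fun u => ?_
      refine (ENNReal.ofReal_le_ofReal (cellKernel_sq_le A x u hh)).trans (le_of_eq ?_)
      unfold indicator
      split_ifs <;> simp
    _ = ENNReal.ofReal (h ^ 3) := by
      rw [lintegral_indicator_const measurableSet_Icc, Real.volume_Icc,
        ← ENNReal.ofReal_mul (by positivity)]
      congr 1
      ring

lemma integral_cellKernel_sq_le (A x : ℝ) {a b h : ℝ} (hh : 0 < h) (hab : a ≤ b) :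
    ∫ u in a..b, cellKernel A h x u ^ 2 ≤ h ^ 3 := by
  rw [intervalIntegral.integral_of_le hab, integral_eq_lintegral_of_nonneg_ae
    (Eventually.of_forall fun u => sq_nonneg _)
    ((measurable_cellKernel_right A h x).pow_const 2).aestronglyMeasurable]
  exact ENNReal.toReal_le_of_le_ofReal (by positivity) (lintegral_cellKernel_sq_le A x hh _)

/-- The observations in a cell. -/
def inCell (A h : ℝ) (t : Fin n → ℝ) (q : ℕ) : Finset (Fin n) :=
  Finset.univ.filter fun i => cell A h (t i) = q

/-- The mean design point in a cell. -/
def cellMean (A h : ℝ) (t : Fin n → ℝ) (q : ℕ) : ℝ :=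
  (∑ i ∈ inCell A h t q, t i) / ((inCell A h t q).card : ℝ)

/-- The sum of squares about the mean of the design points in a cell. -/
def cellScatter (A h : ℝ) (t : Fin n → ℝ) (q : ℕ) : ℝ :=
  ∑ i ∈ inCell A h t q, (t i - cellMean A h t q) ^ 2

/-- The squared length of the projection of the noise `e` on the affine functions on a cell. -/
def cellNoise (A h : ℝ) (t e : Fin n → ℝ) (q : ℕ) : ℝ :=
  (∑ i ∈ inCell A h t q, e i * (1 / √((inCell A h t q).card : ℝ))) ^ 2 +
    (∑ i ∈ inCell A h t q, e i * ((t i - cellMean A h t q) / √(cellScatter A h t q))) ^ 2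

/-- The representer of the noise functional on the Taylor remainders. -/
def remainderNoise (A h : ℝ) (t e : Fin n → ℝ) (u : ℝ) : ℝ := ∑ i, e i * cellKernel A h (t i) u

lemma measurable_remainderNoise (A h : ℝ) (t e : Fin n → ℝ) :
    Measurable (remainderNoise A h t e) :=
  Finset.measurable_sum _ fun i _ => (measurable_cellKernel_right A h (t i)).const_mul _

lemma intervalIntegrable_remainderNoise_sq (A a b : ℝ) {h : ℝ} (hh : 0 < h) (t e : Fin n → ℝ) :
    IntervalIntegrable (fun u => remainderNoise A h t e u ^ 2) volume a b := by
  refine (intervalIntegrable_const (c := (∑ i, |e i| * h) ^ 2)).mono_fun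
    ((measurable_remainderNoise A h t e).pow_const 2).aestronglyMeasurable
    (Eventually.of_forall fun u => ?_)
  simp only
  rw [Real.norm_of_nonneg (sq_nonneg _), Real.norm_of_nonneg (sq_nonneg _), sq_le_sq,
    abs_of_nonneg (a := ∑ i, |e i| * h) (by positivity)]
  refine (Finset.abs_sum_le_sum_abs _ _).trans (Finset.sum_le_sum fun i _ => ?_)
  rw [abs_mul, abs_of_nonneg (cellKernel_nonneg _ _ _ _)]
  exact mul_le_mul_of_nonneg_left (cellKernel_le hh) (abs_nonneg _)

lemma sqrt_add_le_add_sqrt {x y : ℝ} (hx : 0 ≤ x) (hy : 0 ≤ y) : √(x + y) ≤ √x + √y := by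
  rw [Real.sqrt_le_left (by positivity)]
  nlinarith [Real.sq_sqrt hx, Real.sq_sqrt hy, mul_nonneg (Real.sqrt_nonneg x) (Real.sqrt_nonneg y)]

/-- A bound for the noise functional `φ ↦ ∑ eᵢ φ(tᵢ)` which is simultaneous in `φ`. -/
theorem sq_sum_noise_le {A B a b h : ℝ} {M : ℕ} (hh : 0 < h) (hAa : A ≤ a) (hab : a ≤ b)
    (hbB : b ≤ B) (t e : Fin n → ℝ) (ht : ∀ i, t i ∈ Icc a b) (hM : ∀ i, cell A h (t i) < M)
    {φ p : ℝ → ℝ} (hφ : HasACDeriv a b φ p)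
    (hp : IntervalIntegrable (fun x => deriv p x ^ 2) volume a b) :
    (∑ i, e i * φ (t i)) ^ 2 ≤ 6 * ((∑ q ∈ Finset.range M, cellNoise A h t e q) *
        (∑ i, φ (t i) ^ 2) +
      (h ^ 3 * (∑ q ∈ Finset.range M, cellNoise A h t e q * (inCell A h t q).card) +
        ∫ u in A..B, remainderNoise A h t e u ^ 2) * ∫ x in a..b, deriv p x ^ 2) := by
  set J := ∫ x in a..b, deriv p x ^ 2
  set r : Fin n → ℝ := fun i => ∫ u in a..b, cellKernel A h (t i) u * deriv p u with hr
  -- The expansion point of a cell is its left end, moved to `a` if the cell starts before the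
  -- interval on which `φ` is controlled.
  set s : ℕ → ℝ := fun q => max a (A + q * h) with hs
  have hmd : Measurable (deriv p) := measurable_deriv p
  have hAt : ∀ i, A ≤ t i := fun i => hAa.trans (ht i).1
  have htay : ∀ i, φ (t i) = (φ (s (cell A h (t i))) + p (s (cell A h (t i))) *
      (t i - s (cell A h (t i)))) + r i := by
    intro i
    rw [hφ.taylor_indicator (le_max_left a (A + cell A h (t i) * h))
      (max_le (ht i).1 (cell_le hh (hAt i))) (ht i).2]
    congr 1
    apply intervalIntegral.integral_congr
    intro u hu
    rw [uIcc_of_le hab] at hu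
    simp only [cellKernel, max_le_iff, hu.1, true_and]
  -- remainder bound, cell by cell
  set Jc : ℕ → ℝ := fun q => ∫ u in a..b, (if cell A h u = q then deriv p u else 0) ^ 2 with hJc
  have hmc : ∀ q, Measurable fun u => if cell A h u = q then deriv p u else 0 := fun q =>
    Measurable.ite (measurable_cell A h (measurableSet_singleton q)) hmd measurable_const
  have hic : ∀ q, IntervalIntegrable (fun u => (if cell A h u = q then deriv p u else 0) ^ 2)
      volume a b := fun q => by
    refine hp.mono_fun ((hmc q).pow_const 2).aestronglyMeasurable
      (Eventually.of_forall fun u => ?_)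
    simp only
    split_ifs
    · rfl
    · simpa using sq_nonneg _
  have hJc0 : ∀ q, 0 ≤ Jc q := fun q =>
    intervalIntegral.integral_nonneg hab fun x _ => sq_nonneg _
  have hJ0 : 0 ≤ J := intervalIntegral.integral_nonneg hab fun x _ => sq_nonneg _
  have hJsum : ∑ q ∈ Finset.range M, Jc q ≤ J := by
    rw [hJc, ← intervalIntegral.integral_finsetSum fun q _ => hic q]
    refine intervalIntegral.integral_mono_on hab (by
      simpa only [Finset.sum_fn] using IntervalIntegrable.sum (Finset.range M) fun q _ => hic q) hp
      fun u _ => ?_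
    have : ∀ q ∈ Finset.range M, (if cell A h u = q then deriv p u else 0) ^ 2 =
        if cell A h u = q then deriv p u ^ 2 else 0 := fun q _ => by split_ifs <;> simp
    rw [Finset.sum_congr rfl this, Finset.sum_ite_eq]
    split_ifs
    · rfl
    · positivity
  -- The kernel vanishes off the cell of `t i`, so Cauchy-Schwarz involves only that cell's share of
  -- `∫ φ''²`.
  have hr2 : ∀ i, r i ^ 2 ≤ h ^ 3 * Jc (cell A h (t i)) := by
    intro i
    have e1 : r i = ∫ u in a..b, cellKernel A h (t i) u *
        (if cell A h u = cell A h (t i) then deriv p u else 0) := by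
      apply intervalIntegral.integral_congr
      intro u _
      simp only
      split_ifs with hc
      · rfl
      · rw [cellKernel_eq_zero_of_cell_ne hh hc]
        simp
    rw [e1]
    refine (sq_integral_mul_le hab (measurable_cellKernel_right A h _) (hmc _)
      (intervalIntegrable_cellKernel_sq A _ a b hh) (hic _)).trans ?_
    exact mul_le_mul_of_nonneg_right (integral_cellKernel_sq_le A _ hh hab) (hJc0 _)
  -- the affine part
  set ξ := cellNoise A h t e
  set N : ℕ → ℝ := fun q => ((inCell A h t q).card : ℝ)
  have hξ0 : ∀ q, 0 ≤ ξ q := fun q => by simp only [ξ, cellNoise]; positivity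
  set Φ : ℕ → ℝ := fun q => ∑ i ∈ inCell A h t q, φ (t i) ^ 2
  have hΦ0 : ∀ q, 0 ≤ Φ q := fun q => Finset.sum_nonneg fun i _ => sq_nonneg _
  set x : ℕ → ℝ := fun q => ∑ i ∈ inCell A h t q, e i * (φ (t i) - r i) with hx
  have hfib : ∀ f : Fin n → ℝ, ∑ q ∈ Finset.range M, ∑ i ∈ inCell A h t q, f i = ∑ i, f i :=
    fun f => Finset.sum_fiberwise_of_maps_to (fun i _ => Finset.mem_range.2 (hM i)) f
  -- On a cell `φ - r` is affine at the design points, so only the two projections in `cellNoise`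
  -- act on it; its squared norm is in turn at most twice that of `φ` plus twice that of `r`.
  have hx2 : ∀ q, x q ^ 2 ≤ ξ q * (2 * Φ q + 2 * (N q * (h ^ 3 * Jc q))) := by
    intro q
    have hl : ∀ i ∈ inCell A h t q, φ (t i) - r i =
        (φ (s q) - p (s q) * s q) + p (s q) * t i := by
      intro i hi
      have hq : cell A h (t i) = q := (Finset.mem_filter.1 hi).2
      rw [htay i, hq]
      ring
    have h1 : x q = ∑ i ∈ inCell A h t q, e i * ((φ (s q) - p (s q) * s q) + p (s q) * t i) :=
      Finset.sum_congr rfl fun i hi => by rw [hl i hi]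
    rw [h1]
    refine (sq_sum_mul_affine_le _ e t _ _ (cellMean A h t q) (cellScatter A h t q)
      rfl rfl).trans ?_
    refine mul_le_mul_of_nonneg_left ?_ (hξ0 q)
    calc _ = ∑ i ∈ inCell A h t q, (φ (t i) - r i) ^ 2 :=
          Finset.sum_congr rfl fun i hi => by rw [hl i hi]
      _ ≤ ∑ i ∈ inCell A h t q, (2 * φ (t i) ^ 2 + 2 * (h ^ 3 * Jc q)) := by
          refine Finset.sum_le_sum fun i hi => ?_
          have hq : cell A h (t i) = q := (Finset.mem_filter.1 hi).2
          have := hr2 i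
          rw [hq] at this
          nlinarith [sq_nonneg (φ (t i) + r i)]
      _ = _ := by
          rw [Finset.sum_add_distrib, Finset.sum_const, ← Finset.mul_sum, nsmul_eq_mul]
          simp only [Φ, N]
          ring
  set V1 := ∑ q ∈ Finset.range M, ξ q
  set V2 := ∑ q ∈ Finset.range M, ξ q * N q
  set V3 := ∫ u in A..B, remainderNoise A h t e u ^ 2
  set F := ∑ i, φ (t i) ^ 2
  have hF : ∑ q ∈ Finset.range M, Φ q = F := hfib _
  have hF0 : 0 ≤ F := Finset.sum_nonneg fun i _ => sq_nonneg _
  have hV10 : 0 ≤ V1 := Finset.sum_nonneg fun q _ => hξ0 q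
  have hN0 : ∀ q, 0 ≤ N q := fun q => Nat.cast_nonneg _
  have hV20 : 0 ≤ V2 := Finset.sum_nonneg fun q _ => mul_nonneg (hξ0 q) (hN0 q)
  have hP : |∑ q ∈ Finset.range M, x q| ≤ √V1 * √(2 * F) + √V2 * √(2 * h ^ 3 * J) := by
    have h1 : ∀ q, |x q| ≤ √(ξ q) * √(2 * Φ q) + √(ξ q * N q) * √(2 * h ^ 3 * Jc q) := by
      intro q
      refine (Real.abs_le_sqrt (hx2 q)).trans ?_
      rw [← Real.sqrt_mul (hξ0 q), ← Real.sqrt_mul (mul_nonneg (hξ0 q) (hN0 q))]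
      refine (le_of_eq ?_).trans (sqrt_add_le_add_sqrt
        (mul_nonneg (hξ0 q) (mul_nonneg zero_le_two (hΦ0 q))) (by
          have := hξ0 q; have := hN0 q; have := hJc0 q; positivity))
      congr 1
      ring
    refine (Finset.abs_sum_le_sum_abs _ _).trans ((Finset.sum_le_sum fun q _ => h1 q).trans ?_)
    rw [Finset.sum_add_distrib]
    refine add_le_add ?_ ?_
    · refine (Real.sum_sqrt_mul_sqrt_le _ hξ0 fun q => mul_nonneg zero_le_two (hΦ0 q)).trans ?_
      rw [← Finset.mul_sum, hF]
    · refine (Real.sum_sqrt_mul_sqrt_le _ (fun q => mul_nonneg (hξ0 q) (hN0 q))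
        fun q => mul_nonneg (by positivity) (hJc0 q)).trans ?_
      rw [← Finset.mul_sum]
      gcongr
  -- the remainder part
  have hR : (∑ i, e i * r i) ^ 2 ≤ V3 * J := by
    have hki : ∀ i, IntervalIntegrable (fun u => cellKernel A h (t i) u * deriv p u) volume a b :=
      fun i => intervalIntegrable_mul_of_sq (measurable_cellKernel_right A h _) hmd
        (intervalIntegrable_cellKernel_sq A _ a b hh) hp
    have e1 : ∑ i, e i * r i = ∫ u in a..b, remainderNoise A h t e u * deriv p u := by
      simp only [hr, ← intervalIntegral.integral_const_mul]
      rw [← intervalIntegral.integral_finsetSum fun i _ => (hki i).const_mul _]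
      congr 1
      ext u
      rw [remainderNoise, Finset.sum_mul]
      simp only [mul_assoc]
    rw [e1]
    refine (sq_integral_mul_le hab (measurable_remainderNoise A h t e) hmd
      (intervalIntegrable_remainderNoise_sq A a b hh t e) hp).trans ?_
    refine mul_le_mul_of_nonneg_right ?_ hJ0
    -- Passing from the sample range to the fixed interval `[A, B]` makes the expectation of this
    -- integral computable later.
    exact intervalIntegral.integral_mono_interval hAa hab hbB
      (Eventually.of_forall fun u => sq_nonneg _)
      (intervalIntegrable_remainderNoise_sq A A B hh t e)
  have hsum : ∑ i, e i * φ (t i) = ∑ q ∈ Finset.range M, x q + ∑ i, e i * r i := by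
    rw [hx, hfib, ← Finset.sum_add_distrib]
    exact Finset.sum_congr rfl fun i _ => by ring
  rw [hsum]
  have hP2 : (∑ q ∈ Finset.range M, x q) ^ 2 ≤ 4 * (V1 * F) + 4 * (V2 * (h ^ 3 * J)) := by
    calc (∑ q ∈ Finset.range M, x q) ^ 2
        ≤ (√V1 * √(2 * F) + √V2 * √(2 * h ^ 3 * J)) ^ 2 := by
          rw [← sq_abs]; exact pow_le_pow_left₀ (abs_nonneg _) hP 2
      _ ≤ 2 * ((√V1 * √(2 * F)) ^ 2 + (√V2 * √(2 * h ^ 3 * J)) ^ 2) := add_sq_le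
      _ = _ := by
          rw [mul_pow, mul_pow, Real.sq_sqrt hV10, Real.sq_sqrt hV20,
            Real.sq_sqrt (by positivity), Real.sq_sqrt (by positivity)]
          ring
  have hV30 : 0 ≤ V3 * J := (sq_nonneg _).trans hR
  have : 0 ≤ V1 * F := mul_nonneg hV10 hF0
  have : 0 ≤ V2 * (h ^ 3 * J) := by positivity
  -- From `(P - 2 R)² ≥ 0` follows `(P + R)² ≤ (3/2) P² + 3 R²`; with the factor 4 of `hP2` this
  -- yields the constant 6.
  nlinarith [sq_nonneg (∑ q ∈ Finset.range M, x q - 2 * ∑ i, e i * r i)]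

end NoiseInequality

/-! ### From controlled noise to bounded roughness, bounded derivative and the score bound. -/

section Consistency

variable {n : ℕ} {t y : Fin n → ℝ} {μ : ℝ} {ψ : ℝ → ℝ}

/-- The noise functional `φ ↦ n⁻¹ ∑ eᵢ φ(tᵢ)` is controlled by `‖φ‖ₙ` and the roughness of `φ`,
at the squared rate `D`. -/
def NoiseControlled (t e : Fin n → ℝ) (K D : ℝ) : Prop :=
  ∀ φ p : ℝ → ℝ, HasACDeriv (lo t) (hi t) φ p →
    IntervalIntegrable (fun x => deriv p x ^ 2) volume (lo t) (hi t) →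
    ((n : ℝ)⁻¹ * ∑ i, e i * φ (t i)) ^ 2 ≤ K * (D * ((n : ℝ)⁻¹ * ∑ i, φ (t i) ^ 2) +
      D ^ 2 * ∫ x in (lo t)..(hi t), deriv p x ^ 2)

/-- The basic inequality for penalized least squares, solved. -/
lemma basic_inequality {F J Jg S μ D K c : ℝ} (hF : 0 ≤ F) (hJ : 0 ≤ J) (hJg : 0 ≤ Jg)
    (hK : 0 ≤ K) (hc : 0 < c) (hD : 0 < D) (hμ : c * D ≤ μ)
    (hbasic : F + μ * J ≤ 2 * S + μ * Jg)
    (hS : S ^ 2 ≤ K * (D * F + D ^ 2 * (2 * J + 2 * Jg))) :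
    F ≤ (4 * K / c + 8 * K / c ^ 2 + 3 * Jg) * μ ∧ J ≤ 4 * K / c + 8 * K / c ^ 2 + 3 * Jg := by
  have hμ0 : 0 < μ := lt_of_lt_of_le (by positivity) hμ
  have hDμ : D ≤ μ / c := by rw [le_div_iff₀ hc]; linarith
  -- Both terms of the bound on `S²` are split by the arithmetic-geometric mean inequality, with
  -- weights chosen so that, after `D ≤ μ / c`, exactly `F / 2` and `μ J / 2` can be absorbed on the
  -- left.
  have h2S : 2 * S ≤ (F / 2 + 2 * K * D) + D * (4 * K / c + c / 2 * (J + Jg)) := by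
    apply le_of_abs_le
    apply abs_le_of_sq_le_sq _ (by positivity)
    have h1 : 4 * K * D * F ≤ (F / 2 + 2 * K * D) ^ 2 := by
      nlinarith [sq_nonneg (F / 2 - 2 * K * D)]
    have h2 : 8 * K * D ^ 2 * (J + Jg) ≤ (D * (4 * K / c + c / 2 * (J + Jg))) ^ 2 := by
      have : (D * (4 * K / c + c / 2 * (J + Jg))) ^ 2 - 8 * K * D ^ 2 * (J + Jg) =
          (D * (4 * K / c - c / 2 * (J + Jg))) ^ 2 := by
        field_simp
        ring
      nlinarith [sq_nonneg (D * (4 * K / c - c / 2 * (J + Jg)))]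
    have h3 : 0 ≤ (F / 2 + 2 * K * D) * (D * (4 * K / c + c / 2 * (J + Jg))) := by positivity
    nlinarith
  have e1 : 2 * K * D ≤ 2 * K * (μ / c) := by gcongr
  have e2 : D * (4 * K / c + c / 2 * (J + Jg)) ≤ μ / c * (4 * K / c + c / 2 * (J + Jg)) := by
    gcongr
  have e3 : μ / c * (4 * K / c + c / 2 * (J + Jg)) = 4 * K / c ^ 2 * μ + μ * (J + Jg) / 2 := by
    field_simp
  have e4 : 2 * K * (μ / c) = 2 * K / c * μ := by field_simp
  have key : F / 2 + μ * J / 2 ≤ (2 * K / c + 4 * K / c ^ 2 + 3 / 2 * Jg) * μ := by nlinarith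
  have hμJ : 0 ≤ μ * J := by positivity
  have e5 : (4 * K / c + 8 * K / c ^ 2 + 3 * Jg) * μ =
    2 * ((2 * K / c + 4 * K / c ^ 2 + 3 / 2 * Jg) * μ) := by ring
  refine ⟨by rw [e5]; linarith, ?_⟩
  refine le_of_mul_le_mul_right ?_ hμ0
  rw [e5]
  linarith

/-- Otherwise the sum over `s` alone would exceed `n G`. -/
lemma exists_sq_le_of_card {f : Fin n → ℝ} {G ρ : ℝ} (hn : 0 < n) (hρ : 0 < ρ)
    (hf : (n : ℝ)⁻¹ * ∑ i, f i ^ 2 ≤ G) {s : Finset (Fin n)} (hs : ρ * n ≤ s.card) :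
    ∃ i ∈ s, f i ^ 2 ≤ G / ρ := by
  by_contra! hcon
  have hn' : (0 : ℝ) < n := by exact_mod_cast hn
  have hsc : (0 : ℝ) < s.card := lt_of_lt_of_le (by positivity) hs
  have hsne : s.Nonempty := Finset.card_pos.1 (by exact_mod_cast hsc)
  have h1 : ∑ i ∈ s, G / ρ < ∑ i ∈ s, f i ^ 2 := Finset.sum_lt_sum_of_nonempty hsne hcon
  have h2 : ∑ i ∈ s, f i ^ 2 ≤ ∑ i, f i ^ 2 :=
    Finset.sum_le_sum_of_subset_of_nonneg (Finset.subset_univ s) fun i _ _ => sq_nonneg _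
  rw [inv_mul_le_iff₀ hn'] at hf
  have hG : 0 ≤ G := by
    by_contra hG
    have : (n : ℝ) * G < 0 := mul_neg_of_pos_of_neg hn' (not_le.1 hG)
    have : 0 ≤ ∑ i, f i ^ 2 := Finset.sum_nonneg fun i _ => sq_nonneg _
    linarith
  rw [Finset.sum_const, nsmul_eq_mul] at h1
  have h3 : n * G ≤ s.card * (G / ρ) := by
    calc (n : ℝ) * G = (ρ * n) * (G / ρ) := by field_simp
      _ ≤ _ := by gcongr
  linarith

/-- The mean value theorem on `[u, v]` bounds `p` at one point, and `|p'| ≤ 1 + p'²` bounds its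
total variation. -/
lemma HasACDeriv.abs_deriv_le {a b G δ : ℝ} {φ p : ℝ → ℝ} (h : HasACDeriv a b φ p) (hab : a ≤ b)
    (hp : IntervalIntegrable (fun x => deriv p x ^ 2) volume a b) {u v : ℝ} (hu : u ∈ Icc a b)
    (hv : v ∈ Icc a b) (hδ : 0 < δ) (huv : u + δ ≤ v) (hφu : |φ u| ≤ G) (hφv : |φ v| ≤ G) {x : ℝ}
    (hx : x ∈ Icc a b) :
    |p x| ≤ 2 * G / δ + ((b - a) + ∫ x in a..b, deriv p x ^ 2) := by
  have huv' : u < v := by linarith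
  obtain ⟨ξ, hξ, hξe⟩ := exists_hasDerivAt_eq_slope φ p huv'
    (h.continuousOn.mono (Icc_subset_Icc hu.1 hv.2))
    (fun z hz => (h.hasDeriv z ⟨hu.1.trans hz.1.le, hz.2.le.trans hv.2⟩).hasDerivAt
      (Icc_mem_nhds (hu.1.trans_lt hz.1) (hz.2.trans_le hv.2)))
  have h1 : |p ξ| ≤ 2 * G / δ := by
    rw [hξe, abs_div, abs_of_pos (sub_pos.2 huv')]
    have : |φ v - φ u| ≤ 2 * G := (abs_sub _ _).trans (by linarith)
    exact div_le_div₀ ((abs_nonneg _).trans this) this hδ (by linarith)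
  have hξ' : ξ ∈ Icc a b := ⟨hu.1.trans hξ.1.le, hξ.2.le.trans hv.2⟩
  have h2 : |p x - p ξ| ≤ (b - a) + ∫ x in a..b, deriv p x ^ 2 := by
    have hsub : uIcc ξ x ⊆ uIcc a b := by
      rw [uIcc_of_le hab]
      exact uIcc_subset_Icc hξ' hx
    rw [← (h.ac.mono hsub).integral_deriv_eq_sub, ← Real.norm_eq_abs]
    have hi : IntervalIntegrable (fun z => 1 + deriv p z ^ 2) volume a b :=
      intervalIntegrable_const.add hp
    refine intervalIntegral.norm_integral_le_integral_norm_uIoc.trans ?_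
    calc ∫ z in uIoc ξ x, ‖deriv p z‖ ≤ ∫ z in uIoc ξ x, (1 + deriv p z ^ 2) := by
          refine setIntegral_mono_on ?_ ?_ measurableSet_uIoc fun z _ => ?_
          · exact (intervalIntegrable_iff.1 (h.ac.mono hsub).intervalIntegrable_deriv).norm
          · exact intervalIntegrable_iff.1 (hi.mono_set hsub)
          · rw [Real.norm_eq_abs, abs_le]
            constructor <;> nlinarith [sq_nonneg (deriv p z + 1), sq_nonneg (deriv p z - 1)]
      _ ≤ ∫ z in Ioc a b, (1 + deriv p z ^ 2) := by
          refine setIntegral_mono_set ((intervalIntegrable_iff_integrableOn_Ioc_of_le hab).1 hi)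
            (Eventually.of_forall fun z => by positivity) (LE.le.eventuallyLE ?_)
          intro z hz
          exact ⟨(le_min hξ'.1 hx.1).trans_lt hz.1, hz.2.trans (max_le hξ'.2 hx.2)⟩
      _ = _ := by
          rw [← intervalIntegral.integral_of_le hab,
            intervalIntegral.integral_add intervalIntegrable_const hp]
          simp
  calc |p x| = |p ξ + (p x - p ξ)| := by ring_nf
    _ ≤ _ := (abs_add_le _ _).trans (add_le_add h1 h2)

/-- On a sample with controlled noise and spread design the weighted score of the smoothing spline
is of the order of the penalty parameter. -/
theorem exists_score_bound {A B : ℝ} {g : ℝ → ℝ} (hg : MemS2 A B g) {K c ρ l r C : ℝ}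
    (hK : 0 ≤ K) (hc : 0 < c) (hρ : 0 < ρ) (hlr : l < r) (hC : 0 ≤ C) (L : NNReal) :
    ∃ M, 0 < M ∧ ∀ (n : ℕ) (t y : Fin n → ℝ) (μ D : ℝ) (ψ : ℝ → ℝ), 0 < n →
      (∀ i, t i ∈ Icc A B) → IsSmoothingSpline t y μ ψ → 0 < D → c * D ≤ μ → μ ≤ 1 →
      NoiseControlled t (fun i => y i - g (t i)) K D →
      ρ * n ≤ (Finset.univ.filter fun i => t i ≤ l).card →
      ρ * n ≤ (Finset.univ.filter fun i => r ≤ t i).card →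
      ∀ H H' : ℝ → ℝ, (∀ x ∈ Icc A B, HasDerivWithinAt H (H' x) (Icc A B) x) →
        LipschitzOnWith L H' (Icc A B) → (∀ x ∈ Icc A B, |H' x| ≤ C) →
        |(n : ℝ)⁻¹ * ∑ i, (y i - ψ (t i)) *
          (H (t i) * derivWithin ψ (Icc (lo t) (hi t)) (t i))| ≤ M * μ := by
  set pg := derivWithin g (Icc A B) with hpg
  -- The absolute value makes this nonnegative before `A ≤ B` is known, which only a sample
  -- provides.
  set Jg := |∫ x in A..B, deriv pg x ^ 2|
  -- `C₀` is the bound from `basic_inequality`. Below, `G` bounds the spline at one design point of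
  -- each half-line and `M₁` bounds its derivative; none of them depends on the sample.
  set C₀ := 4 * K / c + 8 * K / c ^ 2 + 3 * Jg with hC₀
  have hC₀0 : 0 ≤ C₀ := by positivity
  obtain ⟨G₀, hG₀⟩ := isCompact_Icc.exists_bound_of_continuousOn hg.hasACDeriv.continuousOn
  set G := √((2 * C₀ + 2 * G₀ ^ 2) / ρ)
  set M₁ := 2 * G / (r - l) + (|B - A| + C₀)
  have hM₁ : 0 ≤ M₁ := by
    have : 0 < r - l := by linarith
    positivity
  refine ⟨L * M₁ * |B - A| + (L * M₁ + 2 * C) * C₀ + 1, by positivity, ?_⟩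
  intro n t y μ D ψ hn ht hψ hD hcμ hμ1 hnoise hl hr H H' hH hL hHC
  have hn' : (0 : ℝ) < n := by exact_mod_cast hn
  have hμ0 : 0 < μ := lt_of_lt_of_le (by positivity) hcμ
  have : Nonempty (Fin n) := ⟨⟨0, hn⟩⟩
  have hexists : ∀ s : Finset (Fin n), ρ * n ≤ s.card → s.Nonempty := fun s hs =>
    Finset.card_pos.1 (by
      have : (0 : ℝ) < s.card := lt_of_lt_of_le (by positivity) hs
      exact_mod_cast this)
  have hab : lo t < hi t := by
    obtain ⟨i, hi⟩ := hexists _ hl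
    obtain ⟨k, hk⟩ := hexists _ hr
    have h1 := (Finset.mem_filter.1 hi).2
    have h2 := (Finset.mem_filter.1 hk).2
    linarith [lo_le t i, le_hi t k]
  have hAa : A ≤ lo t := le_ciInf fun i => (ht i).1
  have hbB : hi t ≤ B := ciSup_le fun i => (ht i).2
  have hAB : A < B := hAa.trans_lt (hab.trans_le hbB)
  have hsub : Icc (lo t) (hi t) ⊆ Icc A B := Icc_subset_Icc hAa hbB
  -- the regression function and the spline on the range of the design
  have hgac : HasACDeriv (lo t) (hi t) g pg := hg.hasACDeriv.mono hAa hab.le hbB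
  have hgAB : IntervalIntegrable (fun x => deriv pg x ^ 2) volume A B := hg.sq_integrable
  have hg2 : IntervalIntegrable (fun x => deriv pg x ^ 2) volume (lo t) (hi t) :=
    hgAB.mono_set (by rw [uIcc_of_le hab.le, uIcc_of_le hAB.le]; exact hsub)
  have hJg : ∫ x in (lo t)..(hi t), deriv pg x ^ 2 ≤ Jg :=
    (intervalIntegral.integral_mono_interval hAa hab.le hbB
      (Eventually.of_forall fun u => sq_nonneg _) hgAB).trans (le_abs_self _)
  have hgm : MemS2 (lo t) (hi t) g := hgac.memS2 hab hg2
  have hψac := hψ.1.hasACDeriv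
  set Dψ := derivWithin ψ (Icc (lo t) (hi t)) with hDψ
  have hψ2 : IntervalIntegrable (fun x => deriv Dψ x ^ 2) volume (lo t) (hi t) :=
    hψ.1.sq_integrable
  set J := ∫ x in (lo t)..(hi t), deriv Dψ x ^ 2 with hJdef
  have hJ0 : 0 ≤ J := intervalIntegral.integral_nonneg hab.le fun x _ => sq_nonneg _
  have hJg0 : 0 ≤ ∫ x in (lo t)..(hi t), deriv pg x ^ 2 :=
    intervalIntegral.integral_nonneg hab.le fun x _ => sq_nonneg _
  have hφ := hψac.add_const_mul hgac (-1)
  have hφae := hψac.ae_deriv_add_const_mul hgac (-1)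
  have hφae' : ∀ᵐ x, x ∈ uIoc (lo t) (hi t) → (deriv Dψ x + -1 * deriv pg x) ^ 2 =
      deriv (fun x => Dψ x + -1 * pg x) x ^ 2 := by
    filter_upwards [hφae] with x hx hx'
    rw [hx (uIoc_subset_uIcc hx')]
  have hφ2 : IntervalIntegrable (fun x => deriv (fun x => Dψ x + -1 * pg x) x ^ 2) volume
      (lo t) (hi t) := by
    refine (intervalIntegrable_sq_add_const_mul (measurable_deriv _) (measurable_deriv _) hψ2 hg2
      (-1)).congr_ae ?_
    rwa [EventuallyEq, ae_restrict_iff' measurableSet_uIoc]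
  have hJφ : ∫ x in (lo t)..(hi t), deriv (fun x => Dψ x + -1 * pg x) x ^ 2 ≤ 2 * J + 2 * Jg := by
    rw [← intervalIntegral.integral_congr_ae hφae']
    calc _ ≤ ∫ x in (lo t)..(hi t), (2 * deriv Dψ x ^ 2 + 2 * deriv pg x ^ 2) := by
          refine intervalIntegral.integral_mono_on hab.le
            (intervalIntegrable_sq_add_const_mul (measurable_deriv _) (measurable_deriv _) hψ2 hg2
              (-1)) ((hψ2.const_mul 2).add (hg2.const_mul 2)) fun x _ => ?_
          nlinarith [sq_nonneg (deriv Dψ x + deriv pg x)]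
      _ = 2 * J + 2 * ∫ x in (lo t)..(hi t), deriv pg x ^ 2 := by
          rw [intervalIntegral.integral_add (hψ2.const_mul 2) (hg2.const_mul 2),
            intervalIntegral.integral_const_mul, intervalIntegral.integral_const_mul]
      _ ≤ _ := by linarith
  have hS := hnoise _ _ hφ hφ2
  set F := (n : ℝ)⁻¹ * ∑ i, (ψ (t i) + -1 * g (t i)) ^ 2 with hFdef
  set S := (n : ℝ)⁻¹ * ∑ i, (y i - g (t i)) * (ψ (t i) + -1 * g (t i))
  have hF0 : 0 ≤ F := by positivity
  -- The spline does at least as well in the criterion as `g`; expand the squares around `y - g`.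
  have hbasic : F + μ * J ≤ 2 * S + μ * Jg := by
    have h1 := hψ.2 g hgm
    have h2 : (n : ℝ)⁻¹ * ∑ i, (y i - ψ (t i)) ^ 2 =
        (n : ℝ)⁻¹ * ∑ i, (y i - g (t i)) ^ 2 - 2 * S + F := by
      simp only [S, F]
      rw [← mul_left_comm, ← mul_sub, ← mul_add]
      congr 1
      rw [Finset.mul_sum, ← Finset.sum_sub_distrib, ← Finset.sum_add_distrib]
      exact Finset.sum_congr rfl fun i _ => by ring
    rw [splineCriterion, splineCriterion, hgac.integral_secondDeriv_sq hab,
      hψac.integral_secondDeriv_sq hab, h2] at h1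
    have := mul_le_mul_of_nonneg_left hJg hμ0.le
    linarith
  obtain ⟨hFle, hJle⟩ := basic_inequality hF0 hJ0 (abs_nonneg _) hK hc hD hcμ hbasic
    (hS.trans (by gcongr))
  rw [← hC₀] at hFle hJle
  -- the spline is bounded in quadratic mean
  have hψn : (n : ℝ)⁻¹ * ∑ i, ψ (t i) ^ 2 ≤ 2 * C₀ + 2 * G₀ ^ 2 := by
    calc (n : ℝ)⁻¹ * ∑ i, ψ (t i) ^ 2
        ≤ (n : ℝ)⁻¹ * ∑ i, (2 * (ψ (t i) + -1 * g (t i)) ^ 2 + 2 * G₀ ^ 2) := by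
          gcongr with i
          have h1 : g (t i) ^ 2 ≤ G₀ ^ 2 := by
            rw [← sq_abs (g (t i))]
            exact pow_le_pow_left₀ (abs_nonneg _) (hG₀ _ (ht i)) 2
          nlinarith [sq_nonneg (ψ (t i) - 2 * g (t i))]
      _ = 2 * F + 2 * G₀ ^ 2 := by
          rw [Finset.sum_add_distrib, ← Finset.mul_sum, Finset.sum_const, Finset.card_univ,
            Fintype.card_fin, nsmul_eq_mul, hFdef]
          field_simp
      -- Here `μ ≤ 1` turns `F ≤ C₀ μ` into `F ≤ C₀`.
      _ ≤ _ := by nlinarith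
  obtain ⟨i, hi, hiG⟩ := exists_sq_le_of_card hn hρ hψn hl
  obtain ⟨k, hk, hkG⟩ := exists_sq_le_of_card hn hρ hψn hr
  have hil := (Finset.mem_filter.1 hi).2
  have hkr := (Finset.mem_filter.1 hk).2
  have hM : ∀ x ∈ Icc (lo t) (SplineSIM.hi t), |Dψ x| ≤ M₁ := by
    intro x hx
    refine (hψac.abs_deriv_le hab.le hψ2 ⟨lo_le t i, le_hi t i⟩ ⟨lo_le t k, le_hi t k⟩
      (sub_pos.2 hlr) (by linarith) (Real.abs_le_sqrt hiG) (Real.abs_le_sqrt hkG) hx).trans ?_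
    have : SplineSIM.hi t - lo t ≤ |B - A| := (by linarith : _ ≤ B - A).trans (le_abs_self _)
    simp only [M₁, G]
    gcongr
  refine (hψ.abs_score_le hab hμ0 (fun x hx => (hH x (hsub hx)).mono hsub) (hL.mono hsub)
    (fun x hx => hHC x (hsub hx)) hM).trans ?_
  rw [mul_comm μ]
  refine mul_le_mul_of_nonneg_right ?_ hμ0.le
  have : SplineSIM.hi t - lo t ≤ |B - A| := (by linarith : _ ≤ B - A).trans (le_abs_self _)
  have e1 : ∫ x in (lo t)..(SplineSIM.hi t), secondDeriv (lo t) (SplineSIM.hi t) ψ x ^ 2 = J := rfl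
  rw [e1]
  have h1 : L * M₁ * (SplineSIM.hi t - lo t) ≤ L * M₁ * |B - A| := by gcongr
  have h2 : (L * M₁ + 2 * C) * J ≤ (L * M₁ + 2 * C) * C₀ := by gcongr
  linarith

end Consistency

/-! ### Second moments of noise sums whose coefficients depend on the whole design. -/

section Noise

variable {Ω : Type*} [MeasurableSpace Ω]

/-- By independence the joint law is a product, so `W` can be frozen by Fubini; for frozen `W` the
integrand is `e` times a bounded function of `T`. The bound on `G` may depend on `w`, which permits
other noise variables as factors. -/
lemma integral_mul_comp_eq_zero_of_indepFun {P : Measure Ω} [IsProbabilityMeasure P] {β : Type*}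
    [MeasurableSpace β] {T e : Ω → ℝ} {W : Ω → β} (hT : Measurable T) (he : Measurable e)
    (hW : Measurable W) (hind : IndepFun (fun ω => (T ω, e ω)) W P)
    (h0 : ∀ f : ℝ → ℝ, Measurable f → (∃ C, ∀ x, |f x| ≤ C) → ∫ ω, e ω * f (T ω) ∂P = 0)
    {G : ℝ × β → ℝ} (hG : Measurable G) (hGb : ∀ w, ∃ C, ∀ x, |G (x, w)| ≤ C)
    (hint : Integrable (fun ω => e ω * G (T ω, W ω)) P) :
    ∫ ω, e ω * G (T ω, W ω) ∂P = 0 := by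
  have hZ : Measurable fun ω => (T ω, e ω) := hT.prodMk he
  have hmap := hind.map_prod_eq_prod_map_map hZ.aemeasurable hW.aemeasurable
  have hm : Measurable fun x : (ℝ × ℝ) × β => x.1.2 * G (x.1.1, x.2) := by fun_prop
  have h1 : ∫ ω, e ω * G (T ω, W ω) ∂P = ∫ x, x.1.2 * G (x.1.1, x.2)
      ∂(P.map fun ω => ((T ω, e ω), W ω)) := by
    rw [integral_map (hZ.prodMk hW).aemeasurable hm.aestronglyMeasurable]
  have hint' : Integrable (fun x : (ℝ × ℝ) × β => x.1.2 * G (x.1.1, x.2))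
      (P.map fun ω => ((T ω, e ω), W ω)) := by
    rw [integrable_map_measure hm.aestronglyMeasurable (hZ.prodMk hW).aemeasurable]
    exact hint
  have : IsProbabilityMeasure (P.map fun ω => (T ω, e ω)) :=
    Measure.isProbabilityMeasure_map hZ.aemeasurable
  have : IsProbabilityMeasure (P.map W) := Measure.isProbabilityMeasure_map hW.aemeasurable
  rw [h1]
  rw [hmap] at hint' ⊢
  rw [integral_prod_symm _ hint']
  refine integral_eq_zero_of_ae (Eventually.of_forall fun w => ?_)
  have hmw : Measurable fun x : ℝ × ℝ => x.2 * G (x.1, w) := by fun_prop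
  simp only [Pi.zero_apply]
  rw [integral_map hZ.aemeasurable hmw.aestronglyMeasurable]
  exact h0 (fun x => G (x, w)) (by fun_prop) (hGb w)

/-- The same freezing of `W`, by Tonelli, for the variance bound. -/
lemma lintegral_mul_comp_le_of_indepFun {P : Measure Ω} [IsProbabilityMeasure P] {β : Type*}
    [MeasurableSpace β] {T e : Ω → ℝ} {W : Ω → β} (hT : Measurable T) (he : Measurable e)
    (hW : Measurable W) (hind : IndepFun (fun ω => (T ω, e ω)) W P) {C : ℝ≥0∞}
    (h0 : ∀ f : ℝ → ℝ≥0∞, Measurable f →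
      ∫⁻ ω, ENNReal.ofReal (e ω ^ 2) * f (T ω) ∂P ≤ C * ∫⁻ ω, f (T ω) ∂P)
    {G : ℝ × β → ℝ≥0∞} (hG : Measurable G) :
    ∫⁻ ω, ENNReal.ofReal (e ω ^ 2) * G (T ω, W ω) ∂P ≤ C * ∫⁻ ω, G (T ω, W ω) ∂P := by
  have hZ : Measurable fun ω => (T ω, e ω) := hT.prodMk he
  have hmap := hind.map_prod_eq_prod_map_map hZ.aemeasurable hW.aemeasurable
  have : IsProbabilityMeasure (P.map fun ω => (T ω, e ω)) :=
    Measure.isProbabilityMeasure_map hZ.aemeasurable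
  have : IsProbabilityMeasure (P.map W) := Measure.isProbabilityMeasure_map hW.aemeasurable
  have hm : Measurable fun x : (ℝ × ℝ) × β => ENNReal.ofReal (x.1.2 ^ 2) * G (x.1.1, x.2) := by
    fun_prop
  have hm2 : Measurable fun x : (ℝ × ℝ) × β => G (x.1.1, x.2) := by fun_prop
  have h1 : ∫⁻ ω, ENNReal.ofReal (e ω ^ 2) * G (T ω, W ω) ∂P =
      ∫⁻ x, ENNReal.ofReal (x.1.2 ^ 2) * G (x.1.1, x.2)
        ∂(P.map fun ω => ((T ω, e ω), W ω)) := by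
    rw [lintegral_map hm (hZ.prodMk hW)]
  have h2 : ∫⁻ ω, G (T ω, W ω) ∂P =
      ∫⁻ x, G (x.1.1, x.2) ∂(P.map fun ω => ((T ω, e ω), W ω)) := by
    rw [lintegral_map hm2 (hZ.prodMk hW)]
  rw [h1, h2, hmap, lintegral_prod_symm _ hm.aemeasurable, lintegral_prod_symm _ hm2.aemeasurable,
    ← lintegral_const_mul _ hm2.lintegral_prod_left']
  refine lintegral_mono fun w => ?_
  rw [lintegral_map (f := fun x : ℝ × ℝ => ENNReal.ofReal (x.2 ^ 2) * G (x.1, w))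
    (by fun_prop) hZ, lintegral_map (f := fun x : ℝ × ℝ => G (x.1, w)) (by fun_prop) hZ]
  exact h0 (fun x => G (x, w)) (by fun_prop)

/-- Independent pairs `(T i, e i)` of design points and noise, where the noise is conditionally
centered with bounded conditional variance. -/
structure CenteredNoise (P : Measure Ω) (T e : ℕ → Ω → ℝ) (σ : ℝ) : Prop where
  measurable_design : ∀ i, Measurable (T i)
  measurable_noise : ∀ i, Measurable (e i)
  indep : iIndepFun (fun i ω => (T i ω, e i ω)) P
  memLp : ∀ i, MemLp (e i) 2 P
  mean_zero : ∀ i, ∀ f : ℝ → ℝ, Measurable f → (∃ C, ∀ x, |f x| ≤ C) →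
    ∫ ω, e i ω * f (T i ω) ∂P = 0
  variance_le : ∀ i, ∀ f : ℝ → ℝ≥0∞, Measurable f →
    ∫⁻ ω, ENNReal.ofReal (e i ω ^ 2) * f (T i ω) ∂P ≤ ENNReal.ofReal (σ ^ 2) * ∫⁻ ω, f (T i ω) ∂P

variable {P : Measure Ω} {T e : ℕ → Ω → ℝ} {σ : ℝ}

/-- The other observations, seen from observation `i`. -/
def others (T e : ℕ → Ω → ℝ) (n : ℕ) (i : Fin n) (ω : Ω) :
    (((Finset.univ : Finset (Fin n)).erase i : Finset (Fin n))) → ℝ × ℝ :=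
  fun k => (T k.1 ω, e k.1 ω)

/-- The design rebuilt from observation `i` and the other observations. -/
def rebuild (n : ℕ) (i : Fin n)
    (z : ℝ × ((((Finset.univ : Finset (Fin n)).erase i : Finset (Fin n))) → ℝ × ℝ)) : Fin n → ℝ :=
  fun k => if hk : k = i then z.1 else (z.2 ⟨k, by simp [hk]⟩).1

lemma measurable_rebuild (n : ℕ) (i : Fin n) : Measurable (rebuild n i) := by
  refine measurable_pi_lambda _ fun k => ?_
  unfold rebuild
  split_ifs with hk
  · exact measurable_fst
  · exact measurable_fst.comp ((measurable_pi_apply _).comp measurable_snd)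

lemma rebuild_others {Ω : Type*} {T e : ℕ → Ω → ℝ} (n : ℕ) (i : Fin n) (ω : Ω) :
    rebuild n i (T i ω, others T e n i ω) = fun k : Fin n => T k ω := by
  ext k
  unfold rebuild
  split_ifs with hk
  · rw [hk]
  · rfl

lemma CenteredNoise.measurable_others (h : CenteredNoise P T e σ) (n : ℕ) (i : Fin n) :
    Measurable (others T e n i) :=
  measurable_pi_lambda _ fun _ => (h.measurable_design _).prodMk (h.measurable_noise _)

lemma CenteredNoise.indepFun_others (h : CenteredNoise P T e σ) (n : ℕ) (i : Fin n) :
    IndepFun (fun ω => (T i ω, e i ω)) (others T e n i) P := by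
  have h1 : iIndepFun (fun (k : Fin n) ω => (T k ω, e k ω)) P :=
    h.indep.precomp Fin.val_injective
  have h2 := h1.indepFun_finset {i} (Finset.univ.erase i) (by simp)
    fun k => (h.measurable_design _).prodMk (h.measurable_noise _)
  have h3 : Measurable fun z : ({i} : Finset (Fin n)) → ℝ × ℝ =>
      z ⟨i, Finset.mem_singleton_self i⟩ := measurable_pi_apply _
  exact h2.comp h3 measurable_id

/-- Expand the square: cross terms vanish because `e i` is centered given its own design point and
independent of the other pairs, and each diagonal term is bounded by the conditional variance. The
coefficients may involve every design point, as the cell means and counts do. -/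
lemma CenteredNoise.lintegral_sq_sum_le [IsProbabilityMeasure P] (h : CenteredNoise P T e σ) {n : ℕ}
    {b : Fin n → (Fin n → ℝ) → ℝ} (hb : ∀ i, Measurable (b i)) {C : ℝ} (hC : ∀ i t, |b i t| ≤ C) :
    ∫⁻ ω, ENNReal.ofReal ((∑ i : Fin n, e i ω * b i fun k => T k ω) ^ 2) ∂P ≤
      ENNReal.ofReal (σ ^ 2) *
        ∫⁻ ω, ENNReal.ofReal (∑ i : Fin n, (b i fun k => T k ω) ^ 2) ∂P := by
  have hTm : Measurable fun ω (k : Fin n) => T k ω :=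
    measurable_pi_lambda _ fun k => h.measurable_design k
  have hβ : ∀ i : Fin n, Measurable fun ω => b i fun k => T k ω := fun i => (hb i).comp hTm
  have hem := h.measurable_noise
  have hprod : ∀ i k : Fin n, Integrable (fun ω => (e i ω * b i fun k => T k ω) *
      (e k ω * b k fun k => T k ω)) P := by
    have hL : ∀ i : Fin n, MemLp (fun ω => e i ω * b i fun k => T k ω) 2 P := by
      intro i
      refine (h.memLp i).of_le_mul (c := C) ((hem i).mul (hβ i)).aestronglyMeasurable
        (Eventually.of_forall fun ω => ?_)
      rw [norm_mul, mul_comm]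
      exact mul_le_mul_of_nonneg_right (hC i _) (norm_nonneg _)
    exact fun i k => (hL i).integrable_mul (hL k)
  have hcross : ∀ i k : Fin n, i ≠ k → ∫ ω, (e i ω * b i fun k => T k ω) *
      (e k ω * b k fun k => T k ω) ∂P = 0 := by
    intro i k hik
    have hki : k ∈ (Finset.univ : Finset (Fin n)).erase i := by simp [hik.symm]
    -- Only `e i` is averaged; the factor `e k` belongs to the other observations and is a constant
    -- once they are frozen.
    set G : ℝ × ((((Finset.univ : Finset (Fin n)).erase i : Finset (Fin n))) → ℝ × ℝ) → ℝ :=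
      fun z => b i (rebuild n i z) * ((z.2 ⟨k, hki⟩).2 * b k (rebuild n i z)) with hG
    have hGm : Measurable G := by
      refine ((hb i).comp (measurable_rebuild n i)).mul (Measurable.mul ?_
        ((hb k).comp (measurable_rebuild n i)))
      exact measurable_snd.comp ((measurable_pi_apply _).comp measurable_snd)
    have hGe : ∀ ω, (e i ω * b i fun k => T k ω) * (e k ω * b k fun k => T k ω) =
        e i ω * G (T i ω, others T e n i ω) := by
      intro ω
      simp only [hG, rebuild_others, others]
      ring
    simp only [hGe]
    refine integral_mul_comp_eq_zero_of_indepFun (h.measurable_design i) (hem i)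
      (h.measurable_others n i) (h.indepFun_others n i) (h.mean_zero i) hGm ?_ ?_
    · intro w
      refine ⟨C * (|(w ⟨k, hki⟩).2| * C), fun x => ?_⟩
      simp only [hG, abs_mul]
      have hC0 : 0 ≤ C := (abs_nonneg _).trans (hC i fun _ => 0)
      gcongr <;> apply hC
    · simpa only [hGe] using hprod i k
  have hexp : ∀ ω, (∑ i : Fin n, e i ω * b i fun k => T k ω) ^ 2 =
      ∑ i : Fin n, ∑ k : Fin n, (e i ω * b i fun k => T k ω) * (e k ω * b k fun k => T k ω) := by
    intro ω
    rw [sq, Finset.sum_mul_sum]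
  have hint : ∫ ω, (∑ i : Fin n, e i ω * b i fun k => T k ω) ^ 2 ∂P =
      ∑ i : Fin n, ∫ ω, e i ω ^ 2 * (b i fun k => T k ω) ^ 2 ∂P := by
    simp only [hexp]
    rw [integral_finsetSum _ fun i _ => integrable_finsetSum _ fun k _ => hprod i k]
    refine Finset.sum_congr rfl fun i _ => ?_
    rw [integral_finsetSum _ fun k _ => hprod i k, Finset.sum_eq_single i]
    · congr 1
      ext ω
      ring
    · exact fun k _ hk => hcross i k hk.symm
    · simp
  have hdiag : ∀ i : Fin n, Integrable (fun ω => e i ω ^ 2 * (b i fun k => T k ω) ^ 2) P := by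
    intro i
    refine (hprod i i).congr (Eventually.of_forall fun ω => ?_)
    ring
  rw [← ofReal_integral_eq_lintegral_ofReal ?_ (Eventually.of_forall fun ω => sq_nonneg _), hint,
    ENNReal.ofReal_sum_of_nonneg fun i _ => integral_nonneg fun ω => by positivity]
  swap
  · simp only [hexp]
    exact integrable_finsetSum _ fun i _ => integrable_finsetSum _ fun k _ => hprod i k
  have hrhs : ∫⁻ ω, ENNReal.ofReal (∑ i : Fin n, (b i fun k => T k ω) ^ 2) ∂P =
      ∑ i : Fin n, ∫⁻ ω, ENNReal.ofReal ((b i fun k => T k ω) ^ 2) ∂P := by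
    rw [← lintegral_finsetSum _ fun i _ => ((hβ i).pow_const 2).ennreal_ofReal]
    congr 1
    ext ω
    rw [ENNReal.ofReal_sum_of_nonneg fun i _ => sq_nonneg _]
  rw [hrhs, Finset.mul_sum]
  refine Finset.sum_le_sum fun i _ => ?_
  rw [ofReal_integral_eq_lintegral_ofReal (hdiag i) (Eventually.of_forall fun ω => by positivity)]
  have := lintegral_mul_comp_le_of_indepFun (h.measurable_design i) (hem i)
    (h.measurable_others n i) (h.indepFun_others n i) (h.variance_le i)
    (G := fun z => ENNReal.ofReal (b i (rebuild n i z) ^ 2))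
    (((hb i).comp (measurable_rebuild n i)).pow_const 2).ennreal_ofReal
  simp only [rebuild_others] at this
  refine le_trans (le_of_eq ?_) this
  congr 1
  ext ω
  rw [ENNReal.ofReal_mul (sq_nonneg _)]

end Noise

/-! ### Expected size of the three noise quantities, and control with high probability. -/

section NoiseMoments

variable {n : ℕ}

lemma measurable_sum_inCell {β : Type*} [MeasurableSpace β] (A h : ℝ) (q : ℕ) {t : β → Fin n → ℝ}
    (ht : Measurable t) {f : Fin n → β → ℝ} (hf : ∀ i, Measurable (f i)) :
    Measurable fun z => ∑ i ∈ inCell A h (t z) q, f i z := by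
  simp only [inCell, Finset.sum_filter]
  refine Finset.measurable_sum _ fun i _ => Measurable.ite ?_ (hf i) measurable_const
  exact (measurable_cell A h).comp ((measurable_pi_apply i).comp ht) (measurableSet_singleton q)

lemma measurable_card_inCell (A h : ℝ) (q : ℕ) :
    Measurable fun t : Fin n → ℝ => ((inCell A h t q).card : ℝ) := by
  have := measurable_sum_inCell (n := n) A h q measurable_id (f := fun _ _ => 1)
    fun _ => measurable_const
  simpa using this

lemma measurable_cellMean (A h : ℝ) (q : ℕ) :
    Measurable fun t : Fin n → ℝ => cellMean A h t q :=
  (measurable_sum_inCell A h q measurable_id fun i => measurable_pi_apply i).div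
    (measurable_card_inCell A h q)

lemma measurable_cellScatter (A h : ℝ) (q : ℕ) :
    Measurable fun t : Fin n → ℝ => cellScatter A h t q :=
  measurable_sum_inCell A h q measurable_id fun i =>
    ((measurable_pi_apply i).sub (measurable_cellMean A h q)).pow_const 2

lemma measurable_cellNoise (A h : ℝ) (q : ℕ) :
    Measurable fun z : (Fin n → ℝ) × (Fin n → ℝ) => cellNoise A h z.1 z.2 q := by
  have he : ∀ i, Measurable fun z : (Fin n → ℝ) × (Fin n → ℝ) => z.2 i := fun i =>
    (measurable_pi_apply i).comp measurable_snd
  have ht : ∀ i, Measurable fun z : (Fin n → ℝ) × (Fin n → ℝ) => z.1 i := fun i =>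
    (measurable_pi_apply i).comp measurable_fst
  refine Measurable.add (Measurable.pow_const ?_ 2) (Measurable.pow_const ?_ 2)
  · exact measurable_sum_inCell A h q measurable_fst fun i => (he i).mul
      (measurable_const.div ((measurable_card_inCell A h q).comp measurable_fst).sqrt)
  · exact measurable_sum_inCell A h q measurable_fst fun i => (he i).mul
      (((ht i).sub ((measurable_cellMean A h q).comp measurable_fst)).div
        ((measurable_cellScatter A h q).comp measurable_fst).sqrt)

/-- An inequality and not an equality, because an empty cell gives zero; likewise for zero scatter
in the next lemma. -/
lemma sum_sq_const_div_sqrt_card_le {ι : Type*} (s : Finset ι) :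
    ∑ _i ∈ s, (1 / √(s.card : ℝ)) ^ 2 ≤ 1 := by
  rw [Finset.sum_const, nsmul_eq_mul, div_pow, Real.sq_sqrt (Nat.cast_nonneg _), one_pow,
    mul_one_div]
  exact div_self_le_one _

lemma sum_sq_div_sqrt_sum_sq_le {ι : Type*} (s : Finset ι) (f : ι → ℝ) :
    ∑ i ∈ s, (f i / √(∑ i ∈ s, f i ^ 2)) ^ 2 ≤ 1 := by
  have h0 : 0 ≤ ∑ i ∈ s, f i ^ 2 := Finset.sum_nonneg fun i _ => sq_nonneg _
  simp only [div_pow, Real.sq_sqrt h0]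
  rw [← Finset.sum_div]
  exact div_self_le_one _

variable {Ω : Type*} [MeasurableSpace Ω] {P : Measure Ω} {T e : ℕ → Ω → ℝ} {σ : ℝ}

/-- Second moment bound for one coordinate of the projected noise on a cell, with a weight that
depends on the design. -/
lemma CenteredNoise.lintegral_sq_sum_inCell_le [IsProbabilityMeasure P]
    (hN : CenteredNoise P T e σ) (A h : ℝ) (q : ℕ) {c : Fin n → (Fin n → ℝ) → ℝ}
    (hc : ∀ i, Measurable (c i)) (hc1 : ∀ t, ∑ i ∈ inCell A h t q, c i t ^ 2 ≤ 1)
    {w : (Fin n → ℝ) → ℝ} (hw : Measurable w) (hw0 : ∀ t, 0 ≤ w t) {C : ℝ} (hwC : ∀ t, w t ≤ C) :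
    ∫⁻ ω, ENNReal.ofReal ((∑ i ∈ inCell A h (fun k : Fin n => T k ω) q,
        e i ω * c i fun k => T k ω) ^ 2 * w fun k => T k ω) ∂P ≤
      ENNReal.ofReal (σ ^ 2) * ∫⁻ ω, ENNReal.ofReal (w fun k => T k ω) ∂P := by
  -- The cell membership and the square root of the weight are absorbed into the coefficients, which
  -- reduces the claim to the unweighted second moment bound.
  set b : Fin n → (Fin n → ℝ) → ℝ := fun i t =>
    if cell A h (t i) = q then c i t * √(w t) else 0 with hb
  have hbm : ∀ i, Measurable (b i) := fun i =>
    Measurable.ite ((measurable_cell A h).comp (measurable_pi_apply i) (measurableSet_singleton q))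
      ((hc i).mul hw.sqrt) measurable_const
  have hsum : ∀ t, ∑ i, b i t ^ 2 = (∑ i ∈ inCell A h t q, c i t ^ 2) * w t := by
    intro t
    rw [inCell, Finset.sum_filter, Finset.sum_mul]
    refine Finset.sum_congr rfl fun i _ => ?_
    simp only [hb]
    split_ifs
    · rw [mul_pow, Real.sq_sqrt (hw0 t)]
    · simp
  have hle : ∀ t, ∑ i, b i t ^ 2 ≤ w t := fun t => by
    rw [hsum]
    exact mul_le_of_le_one_left (hw0 t) (hc1 t)
  have hbC : ∀ i t, |b i t| ≤ √C := fun i t => by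
    apply Real.abs_le_sqrt
    exact ((Finset.single_le_sum (fun k _ => sq_nonneg (b k t)) (Finset.mem_univ i)).trans
      (hle t)).trans (hwC t)
  have h1 := hN.lintegral_sq_sum_le hbm hbC
  refine le_trans (le_of_eq ?_) (h1.trans ?_)
  · congr 1
    ext ω
    congr 1
    have : (∑ i : Fin n, e i ω * b i fun k => T k ω) =
        (∑ i ∈ inCell A h (fun k : Fin n => T k ω) q, e i ω * c i fun k => T k ω) *
          √(w fun k => T k ω) := by
      rw [inCell, Finset.sum_filter, Finset.sum_mul]
      refine Finset.sum_congr rfl fun i _ => ?_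
      simp only [hb]
      split_ifs
      · ring
      · simp
    rw [this, mul_pow, Real.sq_sqrt (hw0 _)]
  · gcongr
    exact hle _

/-- The affine functions on a cell span at most two dimensions, and each normalized direction
contributes at most `σ²`; hence the factor 2. The weight is there for the cell counts. -/
lemma CenteredNoise.lintegral_cellNoise_mul_le [IsProbabilityMeasure P]
    (hN : CenteredNoise P T e σ) (A h : ℝ) (q : ℕ)
    {w : (Fin n → ℝ) → ℝ} (hw : Measurable w) (hw0 : ∀ t, 0 ≤ w t) {C : ℝ} (hwC : ∀ t, w t ≤ C) :
    ∫⁻ ω, ENNReal.ofReal (cellNoise A h (fun k : Fin n => T k ω) (fun k => e k ω) q *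
        w fun k => T k ω) ∂P ≤
      2 * ENNReal.ofReal (σ ^ 2) * ∫⁻ ω, ENNReal.ofReal (w fun k => T k ω) ∂P := by
  have h1 := hN.lintegral_sq_sum_inCell_le (n := n) A h q
    (c := fun _ t => 1 / √((inCell A h t q).card : ℝ))
    (fun _ => measurable_const.div (measurable_card_inCell A h q).sqrt)
    (fun t => sum_sq_const_div_sqrt_card_le _) hw hw0 hwC
  have h2 := hN.lintegral_sq_sum_inCell_le (n := n) A h q
    (c := fun i t => (t i - cellMean A h t q) / √(cellScatter A h t q))
    (fun i => ((measurable_pi_apply i).sub (measurable_cellMean A h q)).div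
      (measurable_cellScatter A h q).sqrt)
    (fun t => sum_sq_div_sqrt_sum_sq_le _ _) hw hw0 hwC
  calc _ ≤ ∫⁻ ω, (ENNReal.ofReal ((∑ i ∈ inCell A h (fun k : Fin n => T k ω) q,
        e i ω * (1 / √((inCell A h (fun k : Fin n => T k ω) q).card : ℝ))) ^ 2 *
          w fun k => T k ω) + ENNReal.ofReal ((∑ i ∈ inCell A h (fun k : Fin n => T k ω) q,
        e i ω * ((T i ω - cellMean A h (fun k : Fin n => T k ω) q) /
          √(cellScatter A h (fun k : Fin n => T k ω) q))) ^ 2 * w fun k => T k ω)) ∂P := by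
        refine lintegral_mono fun ω => ?_
        rw [cellNoise, add_mul]
        exact ENNReal.ofReal_add_le
    _ ≤ _ := by
        rw [lintegral_add_left, mul_assoc, two_mul]
        · exact add_le_add h1 h2
        · have hTm : Measurable fun ω (k : Fin n) => T k ω :=
            measurable_pi_lambda _ fun k => hN.measurable_design k
          refine (Measurable.mul (Measurable.pow_const ?_ 2) (hw.comp hTm)).ennreal_ofReal
          exact measurable_sum_inCell A h q hTm fun i => (hN.measurable_noise _).mul
            (measurable_const.div ((measurable_card_inCell A h q).comp hTm).sqrt)

lemma CenteredNoise.lintegral_sum_cellNoise_le [IsProbabilityMeasure P]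
    (hN : CenteredNoise P T e σ) (A h : ℝ) (M : ℕ) :
    ∫⁻ ω, ENNReal.ofReal (∑ q ∈ Finset.range M,
        cellNoise A h (fun k : Fin n => T k ω) (fun k => e k ω) q) ∂P ≤
      ENNReal.ofReal (2 * σ ^ 2 * M) := by
  have hTm : Measurable fun ω (k : Fin n) => T k ω :=
    measurable_pi_lambda _ fun k => hN.measurable_design k
  have hem : Measurable fun ω (k : Fin n) => e k ω :=
    measurable_pi_lambda _ fun k => hN.measurable_noise k
  have h0 : ∀ q ω, 0 ≤ cellNoise A h (fun k : Fin n => T k ω) (fun k => e k ω) q := fun q ω => by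
    unfold cellNoise; positivity
  simp only [fun ω => ENNReal.ofReal_sum_of_nonneg (s := Finset.range M) fun q _ => h0 q ω]
  have hm : ∀ q, Measurable fun ω => ENNReal.ofReal
      (cellNoise A h (fun k : Fin n => T k ω) (fun k => e k ω) q) := fun q =>
    ((measurable_cellNoise A h q).comp (hTm.prodMk hem)).ennreal_ofReal
  rw [lintegral_finsetSum _ fun q _ => hm q]
  have h1 : ∀ q ∈ Finset.range M, ∫⁻ ω, ENNReal.ofReal
      (cellNoise A h (fun k : Fin n => T k ω) (fun k => e k ω) q) ∂P ≤
        ENNReal.ofReal (2 * σ ^ 2) := by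
    intro q _
    have := hN.lintegral_cellNoise_mul_le (n := n) A h q (w := fun _ => 1) measurable_const
      (fun _ => zero_le_one) (fun _ => le_rfl)
    simp only [mul_one, ENNReal.ofReal_one, lintegral_one, measure_univ] at this
    rwa [ENNReal.ofReal_mul zero_le_two, ENNReal.ofReal_ofNat]
  refine (Finset.sum_le_sum h1).trans (le_of_eq ?_)
  rw [Finset.sum_const, Finset.card_range, nsmul_eq_mul, mul_comm,
    ENNReal.ofReal_mul (q := (M : ℝ)) (by positivity), ENNReal.ofReal_natCast]

/-- The number of cells does not enter, because the cell counts add up to at most `n`. -/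
lemma CenteredNoise.lintegral_sum_cellNoise_mul_card_le [IsProbabilityMeasure P]
    (hN : CenteredNoise P T e σ) (A h : ℝ) (M : ℕ) :
    ∫⁻ ω, ENNReal.ofReal (∑ q ∈ Finset.range M,
        cellNoise A h (fun k : Fin n => T k ω) (fun k => e k ω) q *
          (inCell A h (fun k : Fin n => T k ω) q).card) ∂P ≤
      ENNReal.ofReal (2 * σ ^ 2 * n) := by
  have hTm : Measurable fun ω (k : Fin n) => T k ω :=
    measurable_pi_lambda _ fun k => hN.measurable_design k
  have hem : Measurable fun ω (k : Fin n) => e k ω :=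
    measurable_pi_lambda _ fun k => hN.measurable_noise k
  have h0 : ∀ q ω, 0 ≤ cellNoise A h (fun k : Fin n => T k ω) (fun k => e k ω) q *
      (inCell A h (fun k : Fin n => T k ω) q).card := fun q ω => by
    unfold cellNoise; positivity
  simp only [fun ω => ENNReal.ofReal_sum_of_nonneg (s := Finset.range M) fun q _ => h0 q ω]
  have hm : ∀ q, Measurable fun ω => ENNReal.ofReal
      (cellNoise A h (fun k : Fin n => T k ω) (fun k => e k ω) q *
        (inCell A h (fun k : Fin n => T k ω) q).card) := fun q =>
    (((measurable_cellNoise A h q).comp (hTm.prodMk hem)).mul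
      ((measurable_card_inCell A h q).comp hTm)).ennreal_ofReal
  have hmc : ∀ q, Measurable fun ω => ENNReal.ofReal
      ((inCell A h (fun k : Fin n => T k ω) q).card : ℝ) := fun q =>
    ((measurable_card_inCell A h q).comp hTm).ennreal_ofReal
  rw [lintegral_finsetSum _ fun q _ => hm q]
  have h1 : ∀ q ∈ Finset.range M, ∫⁻ ω, ENNReal.ofReal
      (cellNoise A h (fun k : Fin n => T k ω) (fun k => e k ω) q *
        (inCell A h (fun k : Fin n => T k ω) q).card) ∂P ≤ 2 * ENNReal.ofReal (σ ^ 2) *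
        ∫⁻ ω, ENNReal.ofReal ((inCell A h (fun k : Fin n => T k ω) q).card : ℝ) ∂P := by
    intro q _
    refine hN.lintegral_cellNoise_mul_le (n := n) A h q
      (w := fun t => ((inCell A h t q).card : ℝ)) (C := n) (measurable_card_inCell A h q)
      (fun _ => Nat.cast_nonneg _) (fun t => ?_)
    have := Finset.card_le_univ (inCell A h t q)
    rw [Fintype.card_fin] at this
    exact_mod_cast this
  refine (Finset.sum_le_sum h1).trans ?_
  rw [← Finset.mul_sum, ← lintegral_finsetSum _ fun q _ => hmc q]
  rw [ENNReal.ofReal_mul (by positivity), ENNReal.ofReal_mul zero_le_two, ENNReal.ofReal_ofNat]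
  gcongr
  calc _ ≤ ∫⁻ _ω, ENNReal.ofReal n ∂P := by
        refine lintegral_mono fun ω => ?_
        rw [← ENNReal.ofReal_sum_of_nonneg fun q _ => Nat.cast_nonneg _]
        apply ENNReal.ofReal_le_ofReal
        have : ∑ q ∈ Finset.range M, (inCell A h (fun k : Fin n => T k ω) q).card ≤ n := by
          have := Finset.sum_fiberwise_le_sum_of_sum_fiber_nonneg (s := (Finset.univ :
            Finset (Fin n))) (t := Finset.range M) (g := fun k => cell A h (T k ω))
            (f := fun _ => 1) (fun _ _ => Nat.zero_le _)
          simpa [inCell] using this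
        exact_mod_cast this
    _ = _ := by simp

/-- By Tonelli the second moment is taken for each `u` separately; each of the `n` kernels then has
squared `L²` norm at most `h³`. -/
lemma CenteredNoise.lintegral_remainderNoise_le [IsProbabilityMeasure P]
    (hN : CenteredNoise P T e σ) (A B : ℝ) {h : ℝ} (hh : 0 < h) :
    ∫⁻ ω, (∫⁻ u in Ioc A B, ENNReal.ofReal
        (remainderNoise A h (fun k : Fin n => T k ω) (fun k => e k ω) u ^ 2)) ∂P ≤
      ENNReal.ofReal (σ ^ 2 * (n * h ^ 3)) := by
  have hk : ∀ k : Fin n, Measurable fun z : Ω × ℝ => cellKernel A h (T k z.1) z.2 := fun k =>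
    measurable_cellKernel A h ((hN.measurable_design k).comp measurable_fst) measurable_snd
  have hm : Measurable fun z : Ω × ℝ => ENNReal.ofReal
      (remainderNoise A h (fun k : Fin n => T k z.1) (fun k => e k z.1) z.2 ^ 2) := by
    refine (Measurable.pow_const (Finset.measurable_sum _ fun k _ => ?_) 2).ennreal_ofReal
    exact ((hN.measurable_noise k).comp measurable_fst).mul (hk k)
  have hm2 : Measurable fun z : Ω × ℝ => ENNReal.ofReal
      (∑ k : Fin n, cellKernel A h (T k z.1) z.2 ^ 2) :=
    (Finset.measurable_sum _ fun k _ => (hk k).pow_const 2).ennreal_ofReal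
  rw [lintegral_lintegral_swap (f := fun ω u => ENNReal.ofReal
    (remainderNoise A h (fun k : Fin n => T k ω) (fun k => e k ω) u ^ 2)) hm.aemeasurable]
  calc _ ≤ ∫⁻ u in Ioc A B, ENNReal.ofReal (σ ^ 2) *
        ∫⁻ ω, ENNReal.ofReal (∑ k : Fin n, cellKernel A h (T k ω) u ^ 2) ∂P := by
        refine lintegral_mono fun u => ?_
        exact hN.lintegral_sq_sum_le (b := fun k t => cellKernel A h (t k) u) (C := h)
          (fun k => measurable_cellKernel A h (measurable_pi_apply k) measurable_const)
          fun k t => by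
            rw [abs_of_nonneg (cellKernel_nonneg _ _ _ _)]
            exact cellKernel_le hh
    _ = ENNReal.ofReal (σ ^ 2) * ∫⁻ ω, (∫⁻ u in Ioc A B,
        ENNReal.ofReal (∑ k : Fin n, cellKernel A h (T k ω) u ^ 2)) ∂P := by
        rw [lintegral_const_mul _ hm2.lintegral_prod_left',
          lintegral_lintegral_swap (f := fun ω u => ENNReal.ofReal
            (∑ k : Fin n, cellKernel A h (T k ω) u ^ 2)) hm2.aemeasurable]
    _ ≤ ENNReal.ofReal (σ ^ 2) * ∫⁻ _ω, ENNReal.ofReal (n * h ^ 3) ∂P := by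
        gcongr with ω
        simp only [fun u => ENNReal.ofReal_sum_of_nonneg (s := (Finset.univ : Finset (Fin n)))
          fun k _ => sq_nonneg (cellKernel A h (T k ω) u)]
        rw [lintegral_finsetSum _ fun k _ =>
          ((measurable_cellKernel_right A h _).pow_const 2).ennreal_ofReal]
        refine (Finset.sum_le_sum fun k _ => lintegral_cellKernel_sq_le A _ hh _).trans ?_
        rw [Finset.sum_const, Finset.card_univ, Fintype.card_fin, nsmul_eq_mul,
          ENNReal.ofReal_mul (Nat.cast_nonneg _), ENNReal.ofReal_natCast]
    _ = _ := by
        rw [lintegral_const, measure_univ, mul_one, ← ENNReal.ofReal_mul (sq_nonneg σ)]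

/-- Markov's inequality with real bounds. -/
lemma meas_gt_le_of_lintegral_le {f : Ω → ℝ≥0∞} (hf : Measurable f) {a c R : ℝ}
    (ha : 0 < a) (hR : 0 < R) (h : ∫⁻ ω, f ω ∂P ≤ ENNReal.ofReal (c * a)) :
    P {ω | ENNReal.ofReal (R * a) ≤ f ω} ≤ ENNReal.ofReal (c / R) := by
  have hRa : 0 < R * a := by positivity
  refine (meas_ge_le_lintegral_div hf.aemeasurable (by simpa using hRa)
    ENNReal.ofReal_ne_top).trans ?_
  refine (ENNReal.div_le_div_right h _).trans (le_of_eq ?_)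
  rw [← ENNReal.ofReal_div_of_pos hRa]
  congr 1
  field_simp

/-- The relation `n h³ = n² D²` makes both roughness terms of `sq_sum_noise_le` equal after scaling;
their sum doubles the constant 6 to 12. -/
lemma noiseControlled_of_le {A B h D R : ℝ} {t y : Fin n → ℝ} (hn : 0 < n) (hh : 0 < h)
    (hD : 0 < D) (hR : 0 < R) (hnh : (n : ℝ) * h ^ 3 = n ^ 2 * D ^ 2) (hT : ∀ i, t i ∈ Icc A B)
    (h1 : ∑ q ∈ Finset.range (⌊(B - A) / h⌋₊ + 1), cellNoise A h t y q ≤ R * (n * D))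
    (h2 : ∑ q ∈ Finset.range (⌊(B - A) / h⌋₊ + 1), cellNoise A h t y q *
      (inCell A h t q).card ≤ R * n)
    (h3 : ∫⁻ u in Ioc A B, ENNReal.ofReal (remainderNoise A h t y u ^ 2) ≤
      ENNReal.ofReal (R * (n * h ^ 3))) : NoiseControlled t y (12 * R) D := by
  intro φ p hφ hp
  have hn' : (0 : ℝ) < n := by exact_mod_cast hn
  have : Nonempty (Fin n) := ⟨⟨0, hn⟩⟩
  have hAa : A ≤ lo t := le_ciInf fun i => (hT i).1
  have hbB : hi t ≤ B := ciSup_le fun i => (hT i).2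
  have hab : lo t ≤ hi t := (lo_le t ⟨0, hn⟩).trans (le_hi t _)
  have hAB : A ≤ B := hAa.trans (hab.trans hbB)
  have hcell : ∀ i, cell A h (t i) < ⌊(B - A) / h⌋₊ + 1 := fun i => by
    refine Nat.lt_succ_of_le (Nat.floor_le_floor ?_)
    exact div_le_div_of_nonneg_right (sub_le_sub_right (hT i).2 A) hh.le
  have key := sq_sum_noise_le hh hAa hab hbB t y
    (fun i => ⟨lo_le t i, le_hi t i⟩) hcell hφ hp
  have c3 : ∫ u in A..B, remainderNoise A h t y u ^ 2 ≤ R * (n * h ^ 3) := by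
    rw [intervalIntegral.integral_of_le hAB, integral_eq_lintegral_of_nonneg_ae
      (Eventually.of_forall fun u => sq_nonneg _)
      ((measurable_remainderNoise A h t y).pow_const 2).aestronglyMeasurable]
    exact ENNReal.toReal_le_of_le_ofReal (by positivity) h3
  set F := ∑ i, φ (t i) ^ 2
  have hF : 0 ≤ F := Finset.sum_nonneg fun i _ => sq_nonneg _
  set J := ∫ x in (lo t)..(hi t), deriv p x ^ 2
  have hJ : 0 ≤ J := intervalIntegral.integral_nonneg hab fun x _ => sq_nonneg _
  have d : (∑ i, y i * φ (t i)) ^ 2 ≤ 6 * (R * (n * D) * F +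
      (h ^ 3 * (R * n) + R * (n * h ^ 3)) * J) := key.trans (by gcongr)
  have e1 : h ^ 3 * (R * n) + R * (n * h ^ 3) = 2 * R * (n ^ 2 * D ^ 2) := by
    rw [← hnh]; ring
  rw [e1] at d
  rw [mul_pow]
  calc ((n : ℝ)⁻¹) ^ 2 * (∑ i, y i * φ (t i)) ^ 2
      ≤ ((n : ℝ)⁻¹) ^ 2 * (6 * (R * (n * D) * F + 2 * R * (n ^ 2 * D ^ 2) * J)) := by gcongr
    _ = 6 * R * (D * ((n : ℝ)⁻¹ * F)) + 12 * R * (D ^ 2 * J) := by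
        field_simp
        ring
    _ ≤ _ := by
        have : 0 ≤ R * (D * ((n : ℝ)⁻¹ * F)) := by positivity
        linarith

/-- With probability close to one the noise is controlled at the squared rate `n ^ (-4/5)`. -/
theorem CenteredNoise.exists_noiseControlled [IsProbabilityMeasure P]
    (hN : CenteredNoise P T e σ) (A B : ℝ) {ε : ℝ} (hε : 0 < ε) :
    ∃ K, 0 ≤ K ∧ ∀ n : ℕ, 0 < n →
      P {ω | (∀ i : Fin n, T i ω ∈ Icc A B) ∧ ¬ NoiseControlled (fun i : Fin n => T i ω)
        (fun i => e i ω) K ((n : ℝ) ^ (-(4 / 5) : ℝ))} ≤ ENNReal.ofReal ε := by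
  set c₁ := 2 * σ ^ 2 * (|B - A| + 1) with hc₁
  set c := c₁ + 2 * σ ^ 2 + σ ^ 2 with hc
  have hc0 : 0 ≤ c := by positivity
  -- `c` collects the three Markov constants, so the total probability is at most `c / R ≤ ε`; the
  -- `+ 1` keeps `R` positive when `σ = 0`.
  set R := (c + 1) / ε
  have hR : 0 < R := by positivity
  refine ⟨12 * R, by positivity, fun n hn => ?_⟩
  have hn' : (0 : ℝ) < n := by exact_mod_cast hn
  have hn1 : (1 : ℝ) ≤ n := by exact_mod_cast hn
  -- The cell width that balances the number of cells, of order `h⁻¹ = n D`, against the remainder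
  -- size `n h³ = n² D²`, where `D = h⁴`.
  set h : ℝ := (n : ℝ) ^ (-(1 / 5) : ℝ) with hhdef
  set D : ℝ := (n : ℝ) ^ (-(4 / 5) : ℝ) with hDdef
  have hh : 0 < h := Real.rpow_pos_of_pos hn' _
  have hD : 0 < D := Real.rpow_pos_of_pos hn' _
  have hnD : (n : ℝ) * D = h⁻¹ := by
    rw [hDdef, hhdef, ← Real.rpow_neg hn'.le]
    nth_rw 1 [← Real.rpow_one (n : ℝ)]
    rw [← Real.rpow_add hn']
    norm_num
  have hnh : (n : ℝ) * h ^ 3 = n ^ 2 * D ^ 2 := by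
    have h4 : D = h ^ 4 := by
      rw [hDdef, hhdef, ← Real.rpow_natCast, ← Real.rpow_mul hn'.le]
      norm_num
    have h5 : (n : ℝ) * h ^ 5 = 1 := by
      rw [hhdef, ← Real.rpow_natCast, ← Real.rpow_mul hn'.le]
      norm_num
      rw [Real.rpow_neg_one]
      exact mul_inv_cancel₀ hn'.ne'
    rw [h4]
    calc (n : ℝ) * h ^ 3 = n * h ^ 3 * (n * h ^ 5) := by rw [h5, mul_one]
      _ = _ := by ring
  set M : ℕ := ⌊(B - A) / h⌋₊ + 1 with hM
  have hMle : (M : ℝ) ≤ (|B - A| + 1) * (n * D) := by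
    have h1 : (1 : ℝ) ≤ h⁻¹ := by
      rw [hhdef, ← Real.rpow_neg hn'.le]
      exact Real.one_le_rpow hn1 (by norm_num)
    have h2 : (⌊(B - A) / h⌋₊ : ℝ) ≤ |B - A| / h :=
      (Nat.cast_le.2 (Nat.floor_le_floor (by gcongr; exact le_abs_self _))).trans
        (Nat.floor_le (by positivity))
    rw [hM, Nat.cast_add, Nat.cast_one, hnD, add_mul, one_mul, ← div_eq_mul_inv]
    exact add_le_add h2 h1
  have hTm : Measurable fun ω (k : Fin n) => T k ω :=
    measurable_pi_lambda _ fun k => hN.measurable_design k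
  have hem : Measurable fun ω (k : Fin n) => e k ω :=
    measurable_pi_lambda _ fun k => hN.measurable_noise k
  set V1 : Ω → ℝ := fun ω => ∑ q ∈ Finset.range M,
    cellNoise A h (fun k : Fin n => T k ω) (fun k => e k ω) q with hV1
  set V2 : Ω → ℝ := fun ω => ∑ q ∈ Finset.range M,
    cellNoise A h (fun k : Fin n => T k ω) (fun k => e k ω) q *
      (inCell A h (fun k : Fin n => T k ω) q).card with hV2
  set V3 : Ω → ℝ≥0∞ := fun ω => ∫⁻ u in Ioc A B, ENNReal.ofReal
    (remainderNoise A h (fun k : Fin n => T k ω) (fun k => e k ω) u ^ 2) with hV3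
  have m1 : Measurable fun ω => ENNReal.ofReal (V1 ω) :=
    (Finset.measurable_sum _ fun q _ =>
      (measurable_cellNoise A h q).comp (hTm.prodMk hem)).ennreal_ofReal
  have m2 : Measurable fun ω => ENNReal.ofReal (V2 ω) :=
    (Finset.measurable_sum _ fun q _ => ((measurable_cellNoise A h q).comp
      (hTm.prodMk hem)).mul ((measurable_card_inCell A h q).comp hTm)).ennreal_ofReal
  have m3 : Measurable V3 := by
    refine Measurable.lintegral_prod_right' (f := fun z : Ω × ℝ => ENNReal.ofReal
      (remainderNoise A h (fun k : Fin n => T k z.1) (fun k => e k z.1) z.2 ^ 2)) ?_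
    refine (Measurable.pow_const (Finset.measurable_sum _ fun k _ => ?_) 2).ennreal_ofReal
    exact ((hN.measurable_noise k).comp measurable_fst).mul (measurable_cellKernel A h
      ((hN.measurable_design k).comp measurable_fst) measurable_snd)
  have p1 := meas_gt_le_of_lintegral_le (P := P) m1 (a := n * D) (c := c₁) (by positivity) hR
    ((hN.lintegral_sum_cellNoise_le A h M).trans (ENNReal.ofReal_le_ofReal (by
      rw [hc₁, mul_assoc (2 * σ ^ 2)]
      exact mul_le_mul_of_nonneg_left hMle (by positivity))))
  have p2 := meas_gt_le_of_lintegral_le (P := P) m2 (a := n) (c := 2 * σ ^ 2) hn' hR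
    (hN.lintegral_sum_cellNoise_mul_card_le A h M)
  have p3 := meas_gt_le_of_lintegral_le (P := P) m3 (a := n * h ^ 3) (c := σ ^ 2) (by positivity)
    hR (hN.lintegral_remainderNoise_le A B hh)
  refine (measure_mono (t := ({ω | ENNReal.ofReal (R * (n * D)) ≤ ENNReal.ofReal (V1 ω)} ∪
    {ω | ENNReal.ofReal (R * n) ≤ ENNReal.ofReal (V2 ω)}) ∪
    {ω | ENNReal.ofReal (R * (n * h ^ 3)) ≤ V3 ω}) ?_).trans ?_
  · rintro ω ⟨hT, hnc⟩
    by_contra hcon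
    simp only [mem_union, mem_ofPred_eq, not_or, not_le] at hcon
    obtain ⟨⟨b1, b2⟩, b3⟩ := hcon
    refine hnc fun φ p hφ hp => ?_
    have c1 : V1 ω ≤ R * (n * D) := (ENNReal.ofReal_lt_ofReal_iff_of_nonneg (by
      refine Finset.sum_nonneg fun q _ => ?_
      unfold cellNoise; positivity)).1 b1 |>.le
    have c2 : V2 ω ≤ R * n := (ENNReal.ofReal_lt_ofReal_iff_of_nonneg (by
      refine Finset.sum_nonneg fun q _ => ?_
      unfold cellNoise; positivity)).1 b2 |>.le
    exact noiseControlled_of_le hn hh hD hR hnh hT c1 c2 b3.le φ p hφ hp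
  · refine (measure_union_le _ _).trans ((add_le_add ((measure_union_le _ _).trans
      (add_le_add p1 p2)) p3).trans ?_)
    rw [← ENNReal.ofReal_add (by positivity) (by positivity),
      ← ENNReal.ofReal_add (by positivity) (by positivity)]
    apply ENNReal.ofReal_le_ofReal
    rw [← add_div, ← add_div, ← hc, div_le_iff₀ hR]
    have : ε * R = c + 1 := by simp only [R]; field_simp
    linarith

end NoiseMoments

/-! ### Spread of the design: law of large numbers and nondegeneracy. -/

section Design

variable {Ω : Type*} [MeasurableSpace Ω] {P : Measure Ω} [IsProbabilityMeasure P]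

/-- By the law of large numbers, a set of positive probability receives a positive fraction of
the sample. -/
lemma eventually_meas_card_lt_le {T : ℕ → Ω → ℝ} (hT : ∀ i, Measurable (T i))
    (hind : Pairwise fun i j => IndepFun (T i) (T j) P)
    (hid : ∀ i, IdentDistrib (T i) (T 0) P P) {s : Set ℝ} [DecidablePred (· ∈ s)]
    (hs : MeasurableSet s) (hp : 0 < P.real (T 0 ⁻¹' s)) {ε : ℝ} (hε : 0 < ε) :
    ∀ᶠ n : ℕ in atTop, P {ω | ¬ (P.real (T 0 ⁻¹' s) / 2 * n ≤
      ((Finset.univ.filter fun i : Fin n => T i ω ∈ s).card : ℝ))} ≤ ENNReal.ofReal ε := by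
  set p := P.real (T 0 ⁻¹' s)
  set f : ℝ → ℝ := s.indicator fun _ => 1 with hf
  have hfm : Measurable f := measurable_const.indicator hs
  have hfT : ∀ i, (fun ω => f (T i ω)) = (T i ⁻¹' s).indicator fun _ => 1 := fun i => rfl
  have hint : Integrable (fun ω => f (T 0 ω)) P := by
    rw [hfT]
    exact (integrable_const 1).indicator (hT 0 hs)
  have hmean : ∫ ω, f (T 0 ω) ∂P = p := by
    rw [hfT, integral_indicator (hT 0 hs)]
    simp [p]
  have hlln := strong_law_ae_real (fun i ω => f (T i ω)) hint
    (fun i j hij => (hind hij).comp hfm hfm) (fun i => (hid i).comp hfm)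
  rw [hmean] at hlln
  have hprob := tendstoInMeasure_of_tendsto_ae (μ := P) (fun n => Measurable.aestronglyMeasurable
    ((Finset.measurable_sum _ fun i _ => hfm.comp (hT i)).div_const _)) hlln
  rw [tendstoInMeasure_iff_dist] at hprob
  have h1 := (hprob (p / 2) (by positivity)).eventually_le_const
    (u := ENNReal.ofReal ε) (by simpa using hε)
  filter_upwards [h1, eventually_gt_atTop 0] with n hn hn0
  refine (measure_mono fun ω hω => ?_).trans hn
  simp only [mem_ofPred_eq, not_le] at hω ⊢
  have hn' : (0 : ℝ) < n := by exact_mod_cast hn0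
  have hsum : ∑ i ∈ Finset.range n, f (T i ω) =
      ((Finset.univ.filter fun i : Fin n => T i ω ∈ s).card : ℝ) := by
    rw [← Fin.sum_univ_eq_sum_range (fun i => f (T i ω)), Finset.card_filter]
    push_cast
    refine Finset.sum_congr rfl fun i _ => ?_
    simp only [hf, indicator]
    congr
  simp only [Function.comp_apply]
  rw [hsum, Real.dist_eq, abs_sub_comm]
  refine le_trans ?_ (le_abs_self _)
  have : ((Finset.univ.filter fun i : Fin n => T i ω ∈ s).card : ℝ) / n < p / 2 := by
    rw [div_lt_iff₀ hn']
    exact hω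
  linarith

/-- A nondegenerate integrable random variable charges two separated half-lines. -/
lemma exists_separated_half_lines {T : Ω → ℝ} (hint : Integrable T P)
    (hnd : ¬ ∃ c, ∀ᵐ ω ∂P, T ω = c) :
    ∃ l r, l < r ∧ 0 < P.real (T ⁻¹' Iic l) ∧ 0 < P.real (T ⁻¹' Ici r) := by
  set m := ∫ ω, T ω ∂P
  -- If `T` had no mass strictly below its mean, `T - m` would be nonnegative with integral zero, so
  -- `T` would be constant. The same holds for the mass at or above the mean.
  have hlt : P (T ⁻¹' Iio m) ≠ 0 := by
    intro h0
    have hge : 0 ≤ᵐ[P] fun ω => T ω - m := by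
      rw [EventuallyLE, ae_iff]
      refine measure_mono_null (fun ω hω => ?_) h0
      simpa using hω
    have h1 := (integral_eq_zero_iff_of_nonneg_ae hge (hint.sub (integrable_const m))).1 (by
      rw [integral_sub hint (integrable_const m)]
      simp [m])
    exact hnd ⟨m, h1.mono fun ω hω => sub_eq_zero.1 hω⟩
  have hge : P (T ⁻¹' Ici m) ≠ 0 := by
    intro h0
    have hge : 0 ≤ᵐ[P] fun ω => m - T ω := by
      rw [EventuallyLE, ae_iff]
      refine measure_mono_null (fun ω hω => ?_) h0
      have : m < T ω := by simpa using hω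
      exact this.le
    have h1 := (integral_eq_zero_iff_of_nonneg_ae hge ((integrable_const m).sub hint)).1 (by
      rw [integral_sub (integrable_const m) hint]
      simp [m])
    exact hnd ⟨m, h1.mono fun ω hω => (sub_eq_zero.1 hω).symm⟩
  -- The half-lines must be separated: `T < m` is the countable union of the events `T ≤ m - 1 / (k
  -- + 1)`, one of which has positive probability.
  have hex : ∃ k : ℕ, P (T ⁻¹' Iic (m - 1 / (k + 1))) ≠ 0 := by
    by_contra! hcon
    refine hlt (measure_mono_null (fun ω hω => ?_) (measure_iUnion_null hcon))
    obtain ⟨k, hk⟩ := exists_nat_one_div_lt (sub_pos.2 (show T ω < m from hω))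
    exact mem_iUnion.2 ⟨k, show T ω ≤ _ by linarith⟩
  obtain ⟨k, hk⟩ := hex
  refine ⟨m - 1 / (k + 1), m, by have : (0 : ℝ) < 1 / (k + 1) := by positivity
                                 linarith, ?_, ?_⟩
  · exact ENNReal.toReal_pos hk (measure_ne_top _ _)
  · exact ENNReal.toReal_pos hge (measure_ne_top _ _)

end Design

/-! ### Conditional expectations: weighted integrals and transfer between identically distributed
pairs. -/

section Conditional

variable {Ω : Type*} {m : MeasurableSpace Ω} [mΩ : MeasurableSpace Ω] {P : Measure Ω} [IsProbabilityMeasure P]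

/-- A bounded conditional expectation bounds weighted integrals. -/
lemma lintegral_ofReal_mul_le_of_condExp_le (hm : m ≤ mΩ) {Z : Ω → ℝ}
    (hZm : Measurable Z) (hZ0 : ∀ ω, 0 ≤ Z ω) (hZ : Integrable Z P) {C : ℝ}
    (hC : P[Z | m] ≤ᵐ[P] fun _ => C) {F : Ω → ℝ≥0∞} (hF : Measurable[m] F) :
    ∫⁻ ω, ENNReal.ofReal (Z ω) * F ω ∂P ≤ ENNReal.ofReal C * ∫⁻ ω, F ω ∂P := by
  -- Both sides of the claim are integrals of `F` against measures on `m`. It is enough to compare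
  -- those on sets of `m`, where the defining property of the conditional expectation applies.
  have hle : (P.withDensity fun ω => ENNReal.ofReal (Z ω)).trim hm ≤
      ENNReal.ofReal C • P.trim hm := by
    refine Measure.le_iff.2 fun s hs => ?_
    rw [trim_measurableSet_eq hm hs, withDensity_apply _ (hm s hs), Measure.smul_apply,
      trim_measurableSet_eq hm hs, smul_eq_mul, ← ofReal_integral_eq_lintegral_ofReal
        hZ.integrableOn (Eventually.of_forall hZ0), ← setIntegral_condExp hm hZ hs]
    have h1 : ∫ ω in s, (P[Z | m]) ω ∂P ≤ ∫ _ω in s, C ∂P :=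
      integral_mono_ae integrable_condExp.integrableOn (integrable_const C)
        (ae_restrict_of_ae hC)
    refine (ENNReal.ofReal_le_ofReal h1).trans (le_of_eq ?_)
    rw [setIntegral_const, smul_eq_mul, mul_comm]
    rcases le_total 0 C with h0 | h0
    · rw [ENNReal.ofReal_mul h0, Measure.real, ENNReal.ofReal_toReal (measure_ne_top _ _)]
    · rw [ENNReal.ofReal_of_nonpos h0, zero_mul, ENNReal.ofReal_of_nonpos]
      exact mul_nonpos_of_nonpos_of_nonneg h0 measureReal_nonneg
  have h2 := lintegral_mono' hle (le_refl F)
  rw [lintegral_trim hm hF, lintegral_smul_measure, lintegral_trim hm hF,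
    lintegral_withDensity_eq_lintegral_mul _ hZm.ennreal_ofReal (hF.mono hm le_rfl)] at h2
  exact h2

/-- Regression functions are determined by the joint distribution. -/
lemma condExp_comap_eq_of_identDistrib {E : Type*} [NormedAddCommGroup E] [NormedSpace ℝ E]
    [CompleteSpace E] [MeasurableSpace E] [BorelSpace E] [SecondCountableTopology E]
    {X X' : Ω → E} {T T' : Ω → ℝ} (hT : Measurable T) (hT' : Measurable T')
    (hid : IdentDistrib (fun ω => (X' ω, T' ω)) (fun ω => (X ω, T ω)) P P)
    (hint : Integrable X P) {h : ℝ → E} (hh : Measurable h)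
    (hcond : P[X | MeasurableSpace.comap T inferInstance] =ᵐ[P] fun ω => h (T ω)) :
    P[X' | MeasurableSpace.comap T' inferInstance] =ᵐ[P] fun ω => h (T' ω) := by
  have hm := hT.comap_le
  have hm' := hT'.comap_le
  have hidX : IdentDistrib X' X P P := hid.comp measurable_fst
  have hidT : IdentDistrib T' T P P := hid.comp measurable_snd
  have hidh : IdentDistrib (fun ω => h (T' ω)) (fun ω => h (T ω)) P P := hidT.comp hh
  have hint' : Integrable X' P := hidX.integrable_iff.2 hint
  have hih : Integrable (fun ω => h (T ω)) P := integrable_condExp.congr hcond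
  have hih' : Integrable (fun ω => h (T' ω)) P := hidh.integrable_iff.2 hih
  refine (ae_eq_condExp_of_forall_setIntegral_eq hm' hint' (fun s _ _ => hih'.integrableOn) ?_
    (Measurable.aestronglyMeasurable (hh.comp (comap_measurable T')))).symm
  rintro _ ⟨S, hS, rfl⟩ -
  have e1 : ∫ ω in T' ⁻¹' S, h (T' ω) ∂P = ∫ ω in T ⁻¹' S, h (T ω) ∂P := by
    rw [← integral_indicator (hT' hS), ← integral_indicator (hT hS)]
    exact (hidT.comp (u := S.indicator h) (hh.indicator hS)).integral_eq
  have e2 : ∫ ω in T' ⁻¹' S, X' ω ∂P = ∫ ω in T ⁻¹' S, X ω ∂P := by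
    rw [← integral_indicator (hT' hS), ← integral_indicator (hT hS)]
    exact (hid.comp (u := (Prod.snd ⁻¹' S).indicator (Prod.fst : E × ℝ → E))
      (measurable_fst.indicator (measurable_snd hS))).integral_eq
  rw [e1, e2, ← setIntegral_condExp hm hint ⟨S, hS, rfl⟩]
  exact (setIntegral_congr_ae (hT hS) (hcond.mono fun ω hω _ => hω)).symm

lemma integral_sub_mul_eq_zero_of_condExp (hm : m ≤ mΩ) {Y G F : Ω → ℝ}
    (hY : Integrable Y P) (hcond : P[Y | m] =ᵐ[P] G) (hF : StronglyMeasurable[m] F)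
    {C : ℝ} (hC : ∀ ω, |F ω| ≤ C) :
    ∫ ω, (Y ω - G ω) * F ω ∂P = 0 := by
  have hG : Integrable G P := integrable_condExp.congr hcond
  have hb : ∀ Z : Ω → ℝ, Integrable Z P → Integrable (F * Z) P := fun Z hZ =>
    hZ.bdd_mul (hF.mono hm).aestronglyMeasurable (c := C) (Eventually.of_forall hC)
  have h1 : ∫ ω, (F * Y) ω ∂P = ∫ ω, (F * G) ω ∂P := by
    rw [← integral_condExp hm]
    refine integral_congr_ae ?_
    filter_upwards [condExp_mul_of_stronglyMeasurable_left hF (hb Y hY) hY, hcond] with ω h1 h2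
    rw [h1, Pi.mul_apply, h2, Pi.mul_apply]
  have h2 : ∀ ω, (Y ω - G ω) * F ω = (F * Y) ω - (F * G) ω := fun ω => by
    simp only [Pi.mul_apply]; ring
  simp only [h2]
  rw [integral_sub (hb Y hY) (hb G hG), h1, sub_self]

end Conditional

/-! ### Stochastic orders, and reduction of a vector norm to scalar weights. -/

section StochasticOrder

variable {Ω E : Type*} [MeasurableSpace Ω] [NormedAddCommGroup E] {P : Measure Ω}

lemma BigOp.littleOp_of_littleOp {Z : ℕ → Ω → E} {R : ℕ → Ω → ℝ} {S : ℕ → Ω → ℝ}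
    (hZ : BigOp P Z R) (hR : LittleOp P R S) : LittleOp P Z S := by
  intro c hc
  rw [ENNReal.tendsto_nhds_zero]
  intro δ hδ
  obtain ⟨ε, hε, hεδ⟩ : ∃ ε : ℝ, 0 < ε ∧ ENNReal.ofReal ε + ENNReal.ofReal ε ≤ δ := by
    rcases eq_or_ne δ ⊤ with rfl | htop
    · exact ⟨1, one_pos, le_top⟩
    · have h0 : 0 < δ.toReal := ENNReal.toReal_pos hδ.ne' htop
      refine ⟨δ.toReal / 2, by positivity, ?_⟩
      rw [← ENNReal.ofReal_add (by positivity) (by positivity), add_halves,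
        ENNReal.ofReal_toReal htop]
  obtain ⟨M, hM, hMn⟩ := hZ ε hε
  have h2 := (hR (c / M) (by positivity)).eventually_le_const
    (u := ENNReal.ofReal ε) (by simpa using hε)
  filter_upwards [hMn, h2] with n h1 h2
  refine (measure_mono fun ω hω => ?_).trans ((measure_union_le _ _).trans
    ((add_le_add h1 h2).trans hεδ))
  simp only [mem_union, mem_ofPred_eq] at hω ⊢
  by_contra! hcon
  have h3 := mul_le_mul_of_nonneg_left hcon.2 hM.le
  rw [Real.norm_eq_abs] at h3
  have h4 : M * (c / M * |S n ω|) = c * |S n ω| := by field_simp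
  linarith [hcon.1]

/-- Testing with `v = s / ‖s‖` recovers the norm. A bound uniform over `‖v‖ ≤ 1` for the scalar
weights `⟪v, h⟫` therefore bounds the vector score. -/
lemma norm_inv_smul_sum_le {F : Type*} [NormedAddCommGroup F] [InnerProductSpace ℝ F] {n : ℕ}
    {a : Fin n → ℝ} {z : Fin n → F} {K : ℝ} (hK : 0 ≤ K)
    (h : ∀ v : F, ‖v‖ ≤ 1 → |(n : ℝ)⁻¹ * ∑ i, a i * ⟪v, z i⟫| ≤ K) :
    ‖(n : ℝ)⁻¹ • ∑ i, a i • z i‖ ≤ K := by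
  set s := (n : ℝ)⁻¹ • ∑ i, a i • z i with hs
  rcases eq_or_ne s 0 with h0 | h0
  · rw [h0, norm_zero]; exact hK
  have hn : 0 < ‖s‖ := norm_pos_iff.2 h0
  have h1 := h (‖s‖⁻¹ • s) (by rw [norm_smul, norm_inv, norm_norm, inv_mul_cancel₀ hn.ne'])
  have h2 : ∀ v : F, (n : ℝ)⁻¹ * ∑ i, a i * ⟪v, z i⟫ = ⟪v, s⟫ := fun v => by
    rw [hs, real_inner_smul_right, inner_sum]
    simp only [real_inner_smul_right]
  have h3 : ⟪‖s‖⁻¹ • s, s⟫ = ‖s‖ := by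
    rw [real_inner_smul_left, real_inner_self_eq_norm_sq]
    field_simp
  rw [h2, h3, abs_norm] at h1
  exact h1

end StochasticOrder

/-! ### The single index model seen from a fixed direction. -/

section Model

variable {Ω : Type*} [MeasurableSpace Ω] {P : Measure Ω} {d : ℕ}
  {X : ℕ → Ω → EuclideanSpace ℝ (Fin d)} {Y : ℕ → Ω → ℝ} {ψ₀ : ℝ → ℝ}
  {α₀ α : EuclideanSpace ℝ (Fin d)}

lemma measurable_index {X : Ω → EuclideanSpace ℝ (Fin d)} (hX : Measurable X)
    (α : EuclideanSpace ℝ (Fin d)) : Measurable (index α X) :=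
  (measurable_const.inner measurable_id (𝕜 := ℝ)).comp hX

lemma indexSigma_le_comap {Ω : Type*} (α : EuclideanSpace ℝ (Fin d)) (X : Ω → EuclideanSpace ℝ (Fin d)) :
    indexSigma α X ≤ MeasurableSpace.comap X inferInstance := by
  have : Measurable fun x : EuclideanSpace ℝ (Fin d) => ⟪α, x⟫ :=
    measurable_const.inner measurable_id
  rintro _ ⟨S, hS, rfl⟩
  exact ⟨_, this hS, rfl⟩

/-- Regularity in the true direction makes the regression function bounded. -/
lemma RegularDirection.exists_bound [IsProbabilityMeasure P] {X : Ω → EuclideanSpace ℝ (Fin d)} (hX : Measurable X)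
    (hψ₀ : Measurable ψ₀) (hint : Integrable (fun ω => ψ₀ (index α₀ X ω)) P)
    (h : RegularDirection P X ψ₀ α₀ α₀) : ∃ C, ∀ᵐ ω ∂P, |ψ₀ (index α₀ X ω)| ≤ C := by
  obtain ⟨A, B, -, ψ, hAB, -, -, -, hψ, hS⟩ := h
  obtain ⟨C, hC⟩ := isCompact_Icc.exists_bound_of_continuousOn hS.hasACDeriv.continuousOn
  refine ⟨C, ?_⟩
  have hm : StronglyMeasurable[indexSigma α₀ X] fun ω => ψ₀ (index α₀ X ω) :=
    (hψ₀.comp (comap_measurable (index α₀ X))).stronglyMeasurable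
  -- In the direction `α₀` the conditional expectation of `ψ₀(α₀ᵀX)` is the variable itself, so it
  -- agrees almost surely with a function continuous on a compact interval.
  rw [condExp_of_stronglyMeasurable (measurable_index hX α₀).comap_le hm hint] at hψ
  filter_upwards [hψ, hAB] with ω h1 h2
  rw [h1]
  exact hC _ h2

/-- The score vanishes when the design is constant. -/
lemma score_eq_zero_of_design_eq {n : ℕ} {ψ : ℝ → ℝ} {ω : Ω} {c : ℝ}
    (h : ∀ i : Fin n, index α (X i) ω = c) : score P X Y α n ψ ω = 0 := by
  rcases n.eq_zero_or_pos with rfl | hn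
  · simp [score]
  have : Nonempty (Fin n) := ⟨⟨0, hn⟩⟩
  have hd : design α X n ω = fun _ => c := funext h
  -- The range of the design is a single point, where `derivWithin` takes its default value zero.
  have hz : derivWithin ψ {c} c = 0 :=
    derivWithin_zero_of_not_accPt (by rw [accPt_principal_iff_nhdsWithin]; simp)
  simp [score, hd, lo, hi, hz]

/-- In a regular direction, the responses are the regression function of the index plus
conditionally centered noise with bounded conditional variance. -/
lemma centeredNoise_of_model [IsProbabilityMeasure P] (hX : ∀ i, Measurable (X i)) (hY : ∀ i, Measurable (Y i))
    (hindep : iIndepFun (fun i ω => (X i ω, Y i ω)) P)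
    (hident : ∀ i, IdentDistrib (fun ω => (X i ω, Y i ω)) (fun ω => (X 0 ω, Y 0 ω)) P P)
    (hY2 : MemLp (Y 0) 2 P) (hψ₀ : Measurable ψ₀)
    (hmodel : P[Y 0 | MeasurableSpace.comap (X 0) inferInstance] =ᵐ[P]
      fun ω => ψ₀ (index α₀ (X 0) ω))
    {σ : ℝ} (hvar : P[fun ω => (Y 0 ω - ψ₀ (index α₀ (X 0) ω)) ^ 2 |
      MeasurableSpace.comap (X 0) inferInstance] ≤ᵐ[P] fun _ => σ ^ 2)
    {C₀ : ℝ} (hC₀ : ∀ᵐ ω ∂P, |ψ₀ (index α₀ (X 0) ω)| ≤ C₀)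
    {g : ℝ → ℝ} (hg : Measurable g) {C₁ : ℝ} (hC₁ : ∀ x, |g x| ≤ C₁)
    (hcond : P[fun ω => ψ₀ (index α₀ (X 0) ω) | indexSigma α (X 0)] =ᵐ[P]
      fun ω => g (index α (X 0) ω)) :
    CenteredNoise P (fun i => index α (X i)) (fun i ω => Y i ω - g (index α (X i) ω))
      √(2 * σ ^ 2 + 2 * (C₀ + C₁) ^ 2) := by
  have hm := (hX 0).comap_le
  have hmi := (measurable_index (hX 0) α).comap_le
  have hmim := indexSigma_le_comap α (X 0)
  have hYint : Integrable (Y 0) P := hY2.integrable one_le_two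
  set u : EuclideanSpace ℝ (Fin d) × ℝ → ℝ × ℝ := fun z => (⟪α, z.1⟫, z.2 - g ⟪α, z.1⟫) with hu
  have hinner : Measurable fun z : EuclideanSpace ℝ (Fin d) × ℝ => ⟪α, z.1⟫ :=
    measurable_const.inner measurable_fst
  have hum : Measurable u := hinner.prodMk (measurable_snd.sub (hg.comp hinner))
  have hid : ∀ i, IdentDistrib (fun ω => (index α (X i) ω, Y i ω - g (index α (X i) ω)))
      (fun ω => (index α (X 0) ω, Y 0 ω - g (index α (X 0) ω))) P P := fun i =>
    (hident i).comp hum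
  have hTm := fun i => measurable_index (hX i) α
  have he0 : MemLp (fun ω => Y 0 ω - g (index α (X 0) ω)) 2 P :=
    hY2.sub (MemLp.of_bound (hg.comp (hTm 0)).aestronglyMeasurable C₁
      (Eventually.of_forall fun ω => hC₁ _))
  -- Tower property: condition on `X` first, then on the index.
  have hYcond : P[Y 0 | indexSigma α (X 0)] =ᵐ[P] fun ω => g (index α (X 0) ω) :=
    ((condExp_condExp_of_le hmim hm).symm.trans (condExp_congr_ae hmodel)).trans hcond
  refine ⟨hTm, fun i => (hY i).sub (hg.comp (hTm i)), hindep.comp (fun _ => u) fun _ => hum,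
    fun i => ?_, fun i f hf hfb => ?_, fun i f hf => ?_⟩
  · exact ((hid i).comp measurable_snd).memLp_iff.2 he0
  · have h1 := ((hid i).comp (u := fun z => z.2 * f z.1) (by fun_prop)).integral_eq
    simp only [Function.comp_def] at h1
    rw [h1]
    obtain ⟨C, hC⟩ := hfb
    exact integral_sub_mul_eq_zero_of_condExp hmi hYint hYcond
      (hf.comp (comap_measurable (index α (X 0)))).stronglyMeasurable (fun ω => hC _)
  · have h1 := ((hid i).comp (u := fun z => ENNReal.ofReal (z.2 ^ 2) * f z.1)
      (by fun_prop)).lintegral_eq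
    have h2 := ((hid i).comp (u := fun z => f z.1) (by fun_prop)).lintegral_eq
    simp only [Function.comp_def] at h1 h2
    rw [h1, h2, Real.sq_sqrt (by positivity)]
    set ε : Ω → ℝ := fun ω => Y 0 ω - ψ₀ (index α₀ (X 0) ω)
    have hψm : Measurable fun ω => ψ₀ (index α₀ (X 0) ω) :=
      hψ₀.comp (measurable_index (hX 0) α₀)
    have hεm : Measurable ε := (hY 0).sub hψm
    have hε2 : MemLp ε 2 P := hY2.sub (MemLp.of_bound hψm.aestronglyMeasurable C₀ hC₀)
    have hF : Measurable[MeasurableSpace.comap (X 0) inferInstance] fun ω => f (index α (X 0) ω) :=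
      (hf.comp (comap_measurable (index α (X 0)))).mono hmim le_rfl
    have h3 := lintegral_ofReal_mul_le_of_condExp_le hm (hεm.pow_const 2)
      (fun ω => sq_nonneg _) hε2.integrable_sq hvar hF
    have hfT : Measurable fun ω => f (index α (X 0) ω) := hf.comp (hTm 0)
    -- The noise is the model error plus the approximation error `ψ₀(α₀ᵀX) - g(αᵀX)`. The latter is
    -- bounded by `C₀ + C₁`, and `(x + y)² ≤ 2 x² + 2 y²`.
    calc _ ≤ ∫⁻ ω, (2 * (ENNReal.ofReal (ε ω ^ 2) * f (index α (X 0) ω)) +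
          ENNReal.ofReal (2 * (C₀ + C₁) ^ 2) * f (index α (X 0) ω)) ∂P := by
          refine lintegral_mono_ae ?_
          filter_upwards [hC₀] with ω hω
          rw [← mul_assoc, ← add_mul]
          gcongr
          rw [← ENNReal.ofReal_ofNat, ← ENNReal.ofReal_mul zero_le_two,
            ← ENNReal.ofReal_add (by positivity) (by positivity)]
          apply ENNReal.ofReal_le_ofReal
          have hb : |ψ₀ (index α₀ (X 0) ω) - g (index α (X 0) ω)| ≤ C₀ + C₁ :=
            (abs_sub _ _).trans (add_le_add hω (hC₁ _))
          have hb2 := pow_le_pow_left₀ (abs_nonneg _) hb 2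
          rw [sq_abs] at hb2
          have : Y 0 ω - g (index α (X 0) ω) =
              ε ω + (ψ₀ (index α₀ (X 0) ω) - g (index α (X 0) ω)) := by simp only [ε]; ring
          rw [this]
          exact add_sq_le.trans (by linarith)
      _ = 2 * ∫⁻ ω, ENNReal.ofReal (ε ω ^ 2) * f (index α (X 0) ω) ∂P +
          ENNReal.ofReal (2 * (C₀ + C₁) ^ 2) * ∫⁻ ω, f (index α (X 0) ω) ∂P := by
          have hm2 : Measurable fun ω => ENNReal.ofReal (ε ω ^ 2) * f (index α (X 0) ω) :=
            (hεm.pow_const 2).ennreal_ofReal.mul hfT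
          rw [lintegral_add_right _ (hfT.const_mul _), lintegral_const_mul _ hfT,
            lintegral_const_mul _ hm2]
      _ ≤ 2 * (ENNReal.ofReal (σ ^ 2) * ∫⁻ ω, f (index α (X 0) ω) ∂P) +
          ENNReal.ofReal (2 * (C₀ + C₁) ^ 2) * ∫⁻ ω, f (index α (X 0) ω) ∂P := by gcongr
      _ = _ := by
          rw [ENNReal.ofReal_add (by positivity) (by positivity),
            ENNReal.ofReal_mul (p := 2) (q := σ ^ 2) zero_le_two, ENNReal.ofReal_ofNat]
          ring

end Model

/-! ### Assembly: the score in one fixed direction. -/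

section Main

variable {Ω : Type*} [MeasurableSpace Ω] {P : Measure Ω} {d : ℕ}
  {X : ℕ → Ω → EuclideanSpace ℝ (Fin d)} {Y : ℕ → Ω → ℝ} {α : EuclideanSpace ℝ (Fin d)}

/-- Away from degenerate designs, on a good sample the score is of the order of the penalty. -/
lemma exists_norm_score_bound {A B : ℝ} {g : ℝ → ℝ} (hg : MemS2 A B g)
    {h : ℝ → EuclideanSpace ℝ (Fin d)} (hh : DifferentiableOn ℝ h (Icc A B)) {L : NNReal}
    (hL : LipschitzOnWith L (derivWithin h (Icc A B)) (Icc A B)) {K c ρ l r : ℝ}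
    (hK : 0 ≤ K) (hc : 0 < c) (hρ : 0 < ρ) (hlr : l < r) :
    ∃ M, 0 < M ∧ ∀ (n : ℕ) (ω : Ω) (μ D : ℝ) (ψ : ℝ → ℝ), 0 < n →
      (∀ i : Fin n, index α (X i) ω ∈ Icc A B) →
      (∀ i : Fin n, (P[X i | indexSigma α (X i)]) ω = h (index α (X i) ω)) →
      IsSmoothingSpline (design α X n ω) (fun i => Y i ω) μ ψ → 0 < D → c * D ≤ μ → μ ≤ 1 →
      NoiseControlled (design α X n ω) (fun i => Y i ω - g (design α X n ω i)) K D →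
      ρ * n ≤ (Finset.univ.filter fun i => design α X n ω i ≤ l).card →
      ρ * n ≤ (Finset.univ.filter fun i => r ≤ design α X n ω i).card →
      ‖score P X Y α n ψ ω‖ ≤ M * μ := by
  obtain ⟨C, hC⟩ := isCompact_Icc.exists_bound_of_continuousOn hL.continuousOn
  obtain ⟨M, hM, H⟩ := exists_score_bound hg hK hc hρ hlr (le_max_right C 0) L
  refine ⟨M, hM, fun n ω μ D ψ hn ht hcond hψ hD hcμ hμ1 hnoise hl hr => ?_⟩
  have hμ0 : 0 < μ := lt_of_lt_of_le (by positivity) hcμ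
  refine norm_inv_smul_sum_le (by positivity) fun v hv => ?_
  have hLv : LipschitzOnWith L (fun x => ⟪v, derivWithin h (Icc A B) x⟫) (Icc A B) := by
    refine LipschitzOnWith.of_dist_le_mul fun x hx z hz => ?_
    rw [Real.dist_eq, ← inner_sub_right]
    refine (abs_real_inner_le_norm _ _).trans ((mul_le_of_le_one_left (norm_nonneg _) hv).trans ?_)
    rw [← dist_eq_norm]
    exact hL.dist_le_mul x hx z hz
  have key := H n (design α X n ω) (fun i => Y i ω) μ D ψ hn ht hψ hD hcμ hμ1 hnoise hl hr
    (fun x => ⟪v, h x⟫) (fun x => ⟪v, derivWithin h (Icc A B) x⟫)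
    (fun x hx => by
      simpa using (hasDerivWithinAt_const x (Icc A B) v).inner ℝ (hh x hx).hasDerivWithinAt) hLv
    (fun x hx => (abs_real_inner_le_norm _ _).trans ((mul_le_of_le_one_left (norm_nonneg _)
      hv).trans ((hC x hx).trans (le_max_left _ _))))
  refine le_trans (le_of_eq ?_) key
  congr 2
  refine Finset.sum_congr rfl fun i _ => ?_
  rw [hcond i]
  simp only [design]
  ring

/-- The score of the smoothing spline in a fixed regular direction is `O_p (μ n)`. -/
lemma bigOp_score [IsProbabilityMeasure P] (hX : ∀ i, Measurable (X i))
    (hident : ∀ i, IdentDistrib (fun ω => (X i ω, Y i ω)) (fun ω => (X 0 ω, Y 0 ω)) P P)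
    {T : ℝ} (hT : ∀ᵐ ω ∂P, ‖X 0 ω‖ ≤ T) {A B : ℝ} {g : ℝ → ℝ} (hg : MemS2 A B g)
    {h : ℝ → EuclideanSpace ℝ (Fin d)} (hh : DifferentiableOn ℝ h (Icc A B)) {L : NNReal}
    (hL : LipschitzOnWith L (derivWithin h (Icc A B)) (Icc A B))
    (hAB : ∀ᵐ ω ∂P, index α (X 0) ω ∈ Icc A B)
    (hcond : P[X 0 | indexSigma α (X 0)] =ᵐ[P] fun ω => h (index α (X 0) ω)) {σ : ℝ}
    (hnoise : CenteredNoise P (fun i => index α (X i))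
      (fun i ω => Y i ω - (Icc A B).indicator g (index α (X i) ω)) σ)
    {μ : ℕ → Ω → ℝ} (hμ_pos : ∀ n ω, 0 < μ n ω)
    (hμ_upper : LittleOp P μ (fun n _ => (n : ℝ) ^ (-(1 / 2) : ℝ)))
    (hμ_lower : BigOp P (fun n ω => (μ n ω)⁻¹) (fun n _ => (n : ℝ) ^ (4 / 5 : ℝ)))
    {ψhat : ℕ → Ω → ℝ → ℝ} (hψhat : ∀ n ω,
      IsSmoothingSpline (design α X n ω) (fun i => Y i ω) (μ n ω) (ψhat n ω)) :
    BigOp P (fun n ω => score P X Y α n (ψhat n ω) ω) μ := by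
  have hTm := fun i => measurable_index (hX i) α
  have hidX : ∀ i, IdentDistrib (fun ω => (X i ω, index α (X i) ω))
      (fun ω => (X 0 ω, index α (X 0) ω)) P P := fun i => by
    have hu : Measurable fun z : EuclideanSpace ℝ (Fin d) × ℝ => (z.1, ⟪α, z.1⟫) :=
      measurable_fst.prodMk (measurable_const.inner measurable_fst)
    exact (hident i).comp hu
  have hidT : ∀ i, IdentDistrib (index α (X i)) (index α (X 0)) P P := fun i =>
    (hidX i).comp measurable_snd
  have hXint : Integrable (X 0) P :=
    (integrable_const T).mono' (hX 0).aestronglyMeasurable hT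
  -- With an almost surely constant index no two half-lines can be separated, but the score then
  -- vanishes almost surely.
  by_cases hdeg : ∃ c, ∀ᵐ ω ∂P, index α (X 0) ω = c
  · obtain ⟨c, hc⟩ := hdeg
    have hall : ∀ᵐ ω ∂P, ∀ i, index α (X i) ω = c := ae_all_iff.2 fun i =>
      (hidT i).symm.ae_snd (measurableSet_singleton c) hc
    intro ε hε
    refine ⟨1, one_pos, Eventually.of_forall fun n => ?_⟩
    refine le_of_eq_of_le (measure_mono_null (t := {ω | ¬ ∀ i, index α (X i) ω = c})
      (fun ω hω hωc => ?_) hall) zero_le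
    simp only [mem_ofPred_eq, score_eq_zero_of_design_eq fun i : Fin n => hωc i, norm_zero] at hω
    exact absurd hω (not_lt.2 (by positivity))
  have hTint : Integrable (index α (X 0)) P := hXint.const_inner α
  obtain ⟨l, r, hlr, hpl, hpr⟩ := exists_separated_half_lines hTint hdeg
  have hAB' : ∀ᵐ ω ∂P, ∀ i, index α (X i) ω ∈ Icc A B := ae_all_iff.2 fun i =>
    (hidT i).symm.ae_snd measurableSet_Icc hAB
  -- the regression of the covariates on the index
  have hcond' : ∀ᵐ ω ∂P, ∀ i, (P[X i | indexSigma α (X i)]) ω = h (index α (X i) ω) := by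
    rw [ae_all_iff]
    intro i
    -- Nothing is assumed about `h` outside `[A, B]`; cutting it off makes it measurable without
    -- changing it at the observations.
    have hm : Measurable ((Icc A B).indicator h) := by
      rw [← piecewise_eq_indicator]
      exact hh.continuousOn.measurable_piecewise continuousOn_const measurableSet_Icc
    have h0 : P[X 0 | indexSigma α (X 0)] =ᵐ[P]
        fun ω => (Icc A B).indicator h (index α (X 0) ω) := by
      filter_upwards [hcond, hAB] with ω h1 h2
      rw [h1, indicator_of_mem h2]
    filter_upwards [condExp_comap_eq_of_identDistrib (hTm 0) (hTm i) (hidX i) hXint hm h0, hAB']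
      with ω h1 h2
    rw [h1, indicator_of_mem (h2 i)]
  have hpair : Pairwise fun i j => IndepFun (index α (X i)) (index α (X j)) P := fun i j hij =>
    (hnoise.indep.indepFun hij).comp measurable_fst measurable_fst
  intro ε hε
  -- Five exceptional events: `μ` too small, `μ > 1`, too few points in either half-line,
  -- uncontrolled noise.
  have hε5 : 0 < ε / 5 := by positivity
  obtain ⟨K, hK, hKn⟩ := hnoise.exists_noiseControlled A B hε5
  obtain ⟨M₀, hM₀, hlow⟩ := hμ_lower (ε / 5) hε5
  have hup := (hμ_upper 1 one_pos).eventually_le_const (u := ENNReal.ofReal (ε / 5))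
    (by simpa using hε)
  set ρ := min (P.real (index α (X 0) ⁻¹' Iic l) / 2) (P.real (index α (X 0) ⁻¹' Ici r) / 2)
  have hρ : 0 < ρ := lt_min (by positivity) (by positivity)
  have hl := eventually_meas_card_lt_le hTm hpair hidT measurableSet_Iic hpl hε5
  have hr := eventually_meas_card_lt_le hTm hpair hidT measurableSet_Ici hpr hε5
  -- The constant `c = M₀⁻¹` is the one for which `μ ≥ c n^(-4/5)` off the first exceptional event.
  obtain ⟨M, hM, H⟩ := exists_norm_score_bound (P := P) (X := X) (Y := Y) (α := α) hg hh hL hK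
    (inv_pos.2 hM₀) hρ hlr
  refine ⟨M, hM, ?_⟩
  filter_upwards [hlow, hup, hl, hr, eventually_gt_atTop 0] with n e1 e2 e3 e4 hn
  have e5 := hKn n hn
  have hn' : (0 : ℝ) < n := by exact_mod_cast hn
  have hn1 : (1 : ℝ) ≤ n := by exact_mod_cast hn
  set E1 := {ω | M₀ * |(n : ℝ) ^ (4 / 5 : ℝ)| < ‖(μ n ω)⁻¹‖}
  set E2 := {ω | 1 * |(n : ℝ) ^ (-(1 / 2) : ℝ)| < ‖μ n ω‖}
  set E3 := {ω | ¬ (P.real (index α (X 0) ⁻¹' Iic l) / 2 * n ≤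
      ((Finset.univ.filter fun i : Fin n => index α (X i) ω ∈ Iic l).card : ℝ))}
  set E4 := {ω | ¬ (P.real (index α (X 0) ⁻¹' Ici r) / 2 * n ≤
      ((Finset.univ.filter fun i : Fin n => index α (X i) ω ∈ Ici r).card : ℝ))}
  set E5 := {ω | (∀ i : Fin n, index α (X i) ω ∈ Icc A B) ∧ ¬ NoiseControlled
      (fun i : Fin n => index α (X i) ω)
      (fun i => Y i ω - (Icc A B).indicator g (index α (X i) ω)) K ((n : ℝ) ^ (-(4 / 5) : ℝ))}
  have hsub : {ω | M * |μ n ω| < ‖score P X Y α n (ψhat n ω) ω‖} ≤ᵐ[P]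
      (E1 ∪ E2 ∪ E3 ∪ E4 ∪ E5 : Set Ω) := by
    filter_upwards [hAB', hcond'] with ω hωAB hωc hω
    by_contra hcon
    have hcon' : ω ∉ E1 ∪ E2 ∪ E3 ∪ E4 ∪ E5 := hcon
    simp only [mem_union, not_or] at hcon'
    obtain ⟨⟨⟨⟨n1, n2⟩, n3⟩, n4⟩, n5⟩ := hcon'
    simp only [E1, E2, E3, E4, E5, mem_ofPred_eq, not_lt, not_not, not_and] at n1 n2 n3 n4 n5
    have hμ0 := hμ_pos n ω
    have hω' : M * |μ n ω| < ‖score P X Y α n (ψhat n ω) ω‖ := hω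
    rw [abs_of_pos hμ0] at hω'
    refine absurd hω' (not_lt.2 (H n ω (μ n ω) ((n : ℝ) ^ (-(4 / 5) : ℝ)) (ψhat n ω) hn
      (fun i => hωAB i) (fun i => hωc i) (hψhat n ω) (Real.rpow_pos_of_pos hn' _) ?_ ?_ ?_ ?_ ?_))
    · rw [norm_inv, Real.norm_eq_abs, abs_of_pos hμ0,
        abs_of_pos (Real.rpow_pos_of_pos hn' _)] at n1
      rw [Real.rpow_neg hn'.le, ← mul_inv]
      exact inv_le_of_inv_le₀ hμ0 n1
    · rw [Real.norm_eq_abs, abs_of_pos hμ0, one_mul,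
        abs_of_pos (Real.rpow_pos_of_pos hn' _)] at n2
      exact n2.trans (Real.rpow_le_one_of_one_le_of_nonpos hn1 (by norm_num))
    · have := n5 fun i => hωAB i
      have heq : (fun i : Fin n => Y i ω - (Icc A B).indicator g (index α (X i) ω)) =
          fun i : Fin n => Y i ω - g (design α X n ω i) := by
        ext i
        rw [indicator_of_mem (hωAB i)]
        rfl
      rw [heq] at this
      exact this
    · exact (mul_le_mul_of_nonneg_right (min_le_left _ _) hn'.le).trans n3
    · exact (mul_le_mul_of_nonneg_right (min_le_right _ _) hn'.le).trans n4
  refine (measure_mono_ae hsub).trans ?_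
  calc P (E1 ∪ E2 ∪ E3 ∪ E4 ∪ E5) ≤ P E1 + P E2 + P E3 + P E4 + P E5 := by
        refine (measure_union_le _ _).trans (add_le_add_left ?_ _)
        refine (measure_union_le _ _).trans (add_le_add_left ?_ _)
        refine (measure_union_le _ _).trans (add_le_add_left ?_ _)
        exact measure_union_le _ _
    _ ≤ ENNReal.ofReal (ε / 5) + ENNReal.ofReal (ε / 5) + ENNReal.ofReal (ε / 5) +
        ENNReal.ofReal (ε / 5) + ENNReal.ofReal (ε / 5) := by gcongr
    _ = ENNReal.ofReal ε := by
        rw [← ENNReal.ofReal_add hε5.le hε5.le, ← ENNReal.ofReal_add (by positivity) hε5.le,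
          ← ENNReal.ofReal_add (by positivity) hε5.le,
          ← ENNReal.ofReal_add (by positivity) hε5.le]
        congr 1
        ring

end Main

end SplineSIM

end

/-! ### The main theorem. -/

open SplineSIM in
theorem mainTheorem4 {Ω : Type*} [MeasurableSpace Ω] (P : Measure Ω) [IsProbabilityMeasure P]
    {d : ℕ}
    (X : ℕ → Ω → EuclideanSpace ℝ (Fin d)) (Y : ℕ → Ω → ℝ)
    (hX : ∀ i, Measurable (X i)) (hY : ∀ i, Measurable (Y i))
    -- the pairs `(X i, Y i)` are i.i.d.
    (hindep : iIndepFun (fun i ω => (X i ω, Y i ω)) P)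
    (hident : ∀ i, IdentDistrib (fun ω => (X i ω, Y i ω)) (fun ω => (X 0 ω, Y 0 ω)) P P)
    -- bounded covariates, square integrable response
    (T : ℝ) (hT : ∀ᵐ ω ∂P, ‖X 0 ω‖ ≤ T)
    (hY2 : MemLp (Y 0) 2 P)
    -- single index model with bounded conditional error variance
    (α₀ : EuclideanSpace ℝ (Fin d)) (hα₀ : ‖α₀‖ = 1)
    (ψ₀ : ℝ → ℝ) (hψ₀ : Measurable ψ₀)
    (hmodel : P[Y 0 | MeasurableSpace.comap (X 0) inferInstance] =ᵐ[P]
      fun ω => ψ₀ (index α₀ (X 0) ω))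
    (σ : ℝ)
    (hvar : P[fun ω => (Y 0 ω - ψ₀ (index α₀ (X 0) ω)) ^ 2 |
      MeasurableSpace.comap (X 0) inferInstance] ≤ᵐ[P] fun _ => σ ^ 2)
    -- regularity for all directions near `α₀`, including `α₀` itself
    (hreg : ∀ᶠ α in 𝓝[Metric.sphere 0 1] α₀, RegularDirection P (X 0) ψ₀ α₀ α)
    -- the (possibly random) penalty parameter
    (μ : ℕ → Ω → ℝ) (hμ_meas : ∀ n, Measurable (μ n)) (hμ_pos : ∀ n ω, 0 < μ n ω)
    (hμ_upper : LittleOp P μ (fun n _ => (n : ℝ) ^ (-(1 / 2) : ℝ)))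
    (hμ_lower : BigOp P (fun n ω => (μ n ω)⁻¹) (fun n _ => (n : ℝ) ^ (4 / 5 : ℝ)))
    -- the smoothing spline estimators
    (ψhat : EuclideanSpace ℝ (Fin d) → ℕ → Ω → ℝ → ℝ)
    (hψhat : ∀ α ∈ Metric.sphere (0 : EuclideanSpace ℝ (Fin d)) 1, ∀ n ω,
      IsSmoothingSpline (design α X n ω) (fun i => Y i ω) (μ n ω) (ψhat α n ω)) :
    ∀ᶠ α in 𝓝[Metric.sphere 0 1] α₀,
      BigOp P (fun n ω => score P X Y α n (ψhat α n ω) ω) μ ∧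
      LittleOp P (fun n ω => score P X Y α n (ψhat α n ω) ω)
        (fun n _ => (n : ℝ) ^ (-(1 / 2) : ℝ)) := by
  have hsph : α₀ ∈ Metric.sphere (0 : EuclideanSpace ℝ (Fin d)) 1 := by simpa using hα₀
  have hint : Integrable (fun ω => ψ₀ (index α₀ (X 0) ω)) P := integrable_condExp.congr hmodel
  -- Regularity at `α₀` itself serves to bound `ψ₀(α₀ᵀX)`, which is needed in every other direction.
  obtain ⟨C₀, hC₀⟩ := (hreg.self_of_nhdsWithin hsph).exists_bound (hX 0) hψ₀ hint
  filter_upwards [hreg, self_mem_nhdsWithin] with α hα hαs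
  obtain ⟨A, B, h, g, hAB, hcond, hh, ⟨L, hL⟩, hgcond, hg⟩ := hα
  obtain ⟨C₁, hC₁⟩ := isCompact_Icc.exists_bound_of_continuousOn hg.hasACDeriv.continuousOn
  -- `g` is controlled only on `[A, B]`; its cut-off is measurable and bounded on the whole line, as
  -- the noise decomposition requires.
  have hgm : Measurable ((Icc A B).indicator g) := by
    rw [← piecewise_eq_indicator]
    exact hg.hasACDeriv.continuousOn.measurable_piecewise continuousOn_const measurableSet_Icc
  have hgb : ∀ x, |(Icc A B).indicator g x| ≤ max C₁ 0 := fun x => by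
    by_cases hx : x ∈ Icc A B
    · rw [indicator_of_mem hx]
      exact (hC₁ x hx).trans (le_max_left _ _)
    · rw [indicator_of_notMem hx, abs_zero]
      exact le_max_right _ _
  have hgcond' : P[fun ω => ψ₀ (index α₀ (X 0) ω) | indexSigma α (X 0)] =ᵐ[P]
      fun ω => (Icc A B).indicator g (index α (X 0) ω) := by
    filter_upwards [hgcond, hAB] with ω h1 h2
    rw [h1, indicator_of_mem h2]
  have hO := bigOp_score hX hident hT hg hh hL hAB hcond
    (centeredNoise_of_model hX hY hindep hident hY2 hψ₀ hmodel hvar hC₀ hgm hgb hgcond')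
    hμ_pos hμ_upper hμ_lower (hψhat α hαs)
  exact ⟨hO, hO.littleOp_of_littleOp hμ_upper⟩
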